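/- Theorem 4.1. Let $A$ be a unital operator algebra, i.e. a subalgebra of $B(H_0)$ containing the identity, where $H_0$ is a complex Hilbert space ($A$ is not assumed self-adjoint). Equip $M_n(A)$ with the norm induced by $M_n(B(H_0))=B(H_0^{\oplus n})$. For a unital ($\mathbb C$-linear) homomorphism $u\colon A\to B(H)$ into the bounded operators on a complex Hilbert space $H$, let $$\|u\|=\sup\{\|u(a)\| : a\in A,\ \|a\|\le 1\}\in[0,\infty],\qquad \|u\|_{cb}=\sup_{n\ge 1}\ \sup\{\|(u(x_{ij}))\|_{M_n(B(H))} : x\in M_n(A),\ \|x\|\le 1\}\in[0,\infty];$$ $u$ is bounded if $\|u\|<\infty$, completely bounded if $\|u\|_{cb}<\infty$, and completely contractive if $\|u\|_{cb}\le 1$. Then the following are equivalent: (a) For every complex Hilbert space $H$, every bounded unital homomorphism $u\colon A\to B(H)$ is similar to a completely contractive one, i.e. there is an invertible bounded operator $S\colon H\to H$ such that $a\mapsto S^{-1}u(a)S$ is completely contractive. (b) For every complex Hilbert space $H$, every bounded unital homomorphism $u\colon A\to B(H)$ is completely bounded. (c) There are an integer $d\ge 0$ and a constant $K$ such that, for every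 complex Hilbert space $H$, every unital homomorphism $u\colon A\to B(H)$ satisfies $\|u\|_{cb}\le K\|u\|^d$ (where $\infty^0=1$). -/

import Mathlib

open scoped ENNReal NNReal

universe u

noncomputable section

namespace OpAlg

/-- The operator on the Hilbert space direct sum of `n` copies of `H` (with its `ℓ²` norm) given by
an `n × n` matrix of bounded operators on `H`. The norm of `M_n(B(H))` is the operator norm
`‖matOp T‖`. -/
def matOp {H : Type u} [NormedAddCommGroup H] [InnerProductSpace ℂ H] {n : ℕ}
    (T : Matrix (Fin n) (Fin n) (H →L[ℂ] H)) :
    PiLp 2 (fun _ : Fin n => H) →L[ℂ] PiLp 2 (fun _ : Fin n => H) :=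
  ((PiLp.continuousLinearEquiv 2 ℂ (fun _ : Fin n => H)).symm :
      (Fin n → H) →L[ℂ] PiLp 2 (fun _ : Fin n => H)) ∘L
    ContinuousLinearMap.pi fun i => ∑ j, T i j ∘L PiLp.proj 2 (fun _ : Fin n => H) j

theorem matOp_apply {H : Type u} [NormedAddCommGroup H] [InnerProductSpace ℂ H] {n : ℕ}
    (T : Matrix (Fin n) (Fin n) (H →L[ℂ] H)) (x : PiLp 2 (fun _ : Fin n => H)) (i : Fin n) :
    matOp T x i = ∑ j, T i j (x j) := by
  simp [matOp]

section Norms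

variable {H₀ H : Type u} [NormedAddCommGroup H₀] [InnerProductSpace ℂ H₀]
  [NormedAddCommGroup H] [InnerProductSpace ℂ H] {A : Subalgebra ℂ (H₀ →L[ℂ] H₀)}

/-- The norm `‖u‖ ∈ [0, ∞]` of a homomorphism `u : A → B(H)`; it is `∞` iff `u` is unbounded. -/
def opNorm (u : A →ₐ[ℂ] (H →L[ℂ] H)) : ℝ≥0∞ :=
  ⨆ (a : A) (_ : ‖(a : H₀ →L[ℂ] H₀)‖ ≤ 1), ‖u a‖ₑ

/-- The completely bounded norm `‖u‖_cb = sup_n ‖u_n‖ ∈ [0, ∞]` of `u : A → B(H)`, where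
`u_n : M_n(A) → M_n(B(H))` applies `u` entrywise and `M_n(A) ⊆ M_n(B(H₀))` has the induced norm. -/
def cbNorm (u : A →ₐ[ℂ] (H →L[ℂ] H)) : ℝ≥0∞ :=
  ⨆ (n : ℕ) (x : Matrix (Fin n) (Fin n) A)
    (_ : ‖matOp (x.map fun a => (a : H₀ →L[ℂ] H₀))‖ ≤ 1), ‖matOp (x.map u)‖ₑ

/-- `u` is bounded. -/
def IsBdd (u : A →ₐ[ℂ] (H →L[ℂ] H)) : Prop := opNorm u < ∞

/-- `u` is completely bounded. -/
def IsCompletelyBounded (u : A →ₐ[ℂ] (H →L[ℂ] H)) : Prop := cbNorm u < ∞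

/-- `u` is completely contractive. -/
def IsCompletelyContractive (u : A →ₐ[ℂ] (H →L[ℂ] H)) : Prop := cbNorm u ≤ 1

/-- `u` is similar to `v`: there is an invertible bounded `S : H → H` with
`v a = S⁻¹ (u a) S` for all `a`. -/
def IsSimilar (u v : A →ₐ[ℂ] (H →L[ℂ] H)) : Prop :=
  ∃ S : (H →L[ℂ] H)ˣ, ∀ a : A, v a = (↑S⁻¹ : H →L[ℂ] H) * u a * (S : H →L[ℂ] H)

end Norms

end OpAlg

end

noncomputable section

namespace OpAlg

/-! Both hard implications rest on one duality scheme. Sought is a positive form on a module `M`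
obeying a family of inequalities. A form is a positive functional on functions such as `φ ↦ ‖φ m‖²`
on the algebraic dual, and the M. Riesz extension theorem (`exists_core_of_consistent`) supplies it
once the inequalities cannot be combined into a contradiction. A combination says that the squares
of `(h, q)` are dominated by those of `(x h, p)`. Gram domination
(`exists_contractive_matrix_of_dual_sum_le`) then gives a contractive scalar matrix α with `(h, q) =
α (x h, p)`, and eliminating `h` gives formally `q = (α₂₂ + α₂₁ x (1 - α₁₁ x)⁻¹ α₁₂) p`: a transfer
function of `x`, applied to `p`.

From completely bounded to similar: take `M = H` and ask that `v` be completely contractive for the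
form and that the form lie between `‖·‖²` and `K² ‖·‖²`. Transfer functions are contractive at
contractive `x` (`feedbackSum_mean_matBdd`, in Cesàro mean), so `‖q‖ ≤ K ‖p‖` and no contradiction
arises (`norm_le_of_feedback`). The square root of the form is the similarity.

From completely bounded to a polynomial bound: direct sums give one constant Φ bounding the cb norm
of every homomorphism of norm at most 2. Let `f` be a functional on `M_n(A)` bounded by 1 on
transfer functions at `½ diag(g)`, with the `g i` contractions in `A`. The scheme on `M = Aⁿ` yields
a homomorphism `v` of norm at most 2 with `‖f x‖ ≤ ‖v x‖`, hence `‖f x‖ ≤ Φ` for contractive `x`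
(`norm_functional_le`). By Hahn–Banach `x / Φ` is a limit of sums `∑ 2⁻ᵏ z_k`, where any
homomorphism of norm at most `C` is bounded by `Cᵏ` on `z_k`. Cutting at a large fixed `d` gives `x
= y + e` with `‖e‖ ≤ 1/2` and `‖v y‖ ≤ Φ d Cᵈ` for `C ≥ 1`. So a bound `W` on contractive matrices
improves to `Φ d Cᵈ + W / 2`, and iterating leaves `2 Φ d Cᵈ`. -/

/-! ### Positive forms from consistent inequalities -/

/-- Gram domination: if the quadratic form of `k` is dominated by the one of `h` on the algebraic
dual, then `k` is the image of `h` under a contractive scalar matrix. -/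
theorem exists_contractive_matrix_of_dual_sum_le {M : Type*} [AddCommGroup M] [Module ℂ M]
    {ι κ : Type*} [Fintype ι] [Fintype κ] (h : ι → M) (k : κ → M)
    (hle : ∀ φ : Module.Dual ℂ M, ∑ j, ‖φ (k j)‖ ^ 2 ≤ ∑ i, ‖φ (h i)‖ ^ 2) :
    ∃ α : Matrix κ ι ℂ, (∀ z : ι → ℂ, ∑ j, ‖∑ i, α j i * z i‖ ^ 2 ≤ ∑ i, ‖z i‖ ^ 2) ∧
      ∀ j, k j = ∑ i, α j i • h i := by
  classical
  let E : Module.Dual ℂ M →ₗ[ℂ] EuclideanSpace ℂ ι :=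
    { toFun := fun φ => WithLp.toLp 2 fun i => φ (h i)
      map_add' := fun _ _ => rfl
      map_smul' := fun _ _ => rfl }
  let G : Module.Dual ℂ M →ₗ[ℂ] EuclideanSpace ℂ κ :=
    { toFun := fun φ => WithLp.toLp 2 fun i => φ (k i)
      map_add' := fun _ _ => rfl
      map_smul' := fun _ _ => rfl }
  have hEG : ∀ φ, ‖G φ‖ ≤ ‖E φ‖ := fun φ => by
    rw [← sq_le_sq₀ (norm_nonneg _) (norm_nonneg _), EuclideanSpace.norm_sq_eq,
      EuclideanSpace.norm_sq_eq]
    exact hle φ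
  have hker : E.ker ≤ G.ker := fun φ hφ => by
    rw [LinearMap.mem_ker] at hφ ⊢
    have := hEG φ
    rw [hφ, norm_zero] at this
    exact norm_le_zero_iff.1 this
  -- The domination makes `E φ ↦ G φ` well defined and contractive on the range of `E`; the
  -- orthogonal projection extends it to the whole space.
  let L₀ : E.range →ₗ[ℂ] EuclideanSpace ℂ κ :=
    E.ker.liftQ G hker ∘ₗ E.quotKerEquivRange.symm.toLinearMap
  have hL₀ : ∀ φ, L₀ ⟨E φ, φ, rfl⟩ = G φ := fun φ => by
    have : E.quotKerEquivRange.symm ⟨E φ, φ, rfl⟩ = E.ker.mkQ φ := by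
      rw [LinearEquiv.symm_apply_eq]; rfl
    simp [L₀, this]
  let L : EuclideanSpace ℂ ι →ₗ[ℂ] EuclideanSpace ℂ κ :=
    L₀ ∘ₗ (E.range.orthogonalProjectionOnto).toLinearMap
  have hL : ∀ φ, L (E φ) = G φ := fun φ => by
    have : E.range.orthogonalProjectionOnto (E φ) = ⟨E φ, φ, rfl⟩ :=
      Submodule.orthogonalProjectionOnto_mem_subspace_eq_self (K := E.range) ⟨E φ, φ, rfl⟩
    simp only [L, LinearMap.comp_apply, ContinuousLinearMap.coe_coe, this, hL₀]
  have hLc : ∀ z, ‖L z‖ ≤ ‖z‖ := fun z => by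
    obtain ⟨φ, hφ⟩ := (E.range.orthogonalProjectionOnto z).2
    have h1 : E.range.orthogonalProjectionOnto z = ⟨E φ, φ, rfl⟩ := Subtype.ext hφ.symm
    calc ‖L z‖ = ‖G φ‖ := by
          simp only [L, LinearMap.comp_apply, ContinuousLinearMap.coe_coe, h1, hL₀]
      _ ≤ ‖E φ‖ := hEG φ
      _ = ‖E.range.orthogonalProjectionOnto z‖ := by rw [h1]; rfl
      _ ≤ ‖z‖ := Submodule.norm_orthogonalProjectionOnto_apply_le _ _
  have hsum : ∀ (z : EuclideanSpace ℂ ι) (j : κ),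
      L z j = ∑ i, L (EuclideanSpace.single i 1) j * z i := fun z j => by
    have hz : z = ∑ i, z i • EuclideanSpace.single i (1 : ℂ) := by
      ext l; simp [Finset.sum_apply, Pi.single_apply]
    conv_lhs => rw [hz]
    rw [map_sum, WithLp.ofLp_sum, Finset.sum_apply]
    exact Finset.sum_congr rfl fun i _ => by
      rw [map_smul, PiLp.smul_apply, smul_eq_mul, mul_comm]
  refine ⟨Matrix.of fun j i => L (EuclideanSpace.single i 1) j, fun z => ?_, fun j => ?_⟩
  · have := hLc (WithLp.toLp 2 z)
    rw [← sq_le_sq₀ (norm_nonneg _) (norm_nonneg _), EuclideanSpace.norm_sq_eq,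
      EuclideanSpace.norm_sq_eq] at this
    have h1 := fun j => hsum (WithLp.toLp 2 z) j
    generalize L (WithLp.toLp 2 z) = w at h1 this
    simpa [h1] using this
  -- The algebraic dual separates points, so the identity may be tested on functionals.
  · rw [← sub_eq_zero, ← Module.forall_dual_apply_eq_zero_iff ℂ]
    intro φ
    have h1 : G φ j = φ (k j) := rfl
    have h2 : ∀ i, E φ i = φ (h i) := fun _ => rfl
    rw [map_sub, ← h1, ← hL, hsum]
    simp [h2]

/-- Functions on the dual dominated by finite sums of squares. -/
def dominatedFunctions (M : Type*) [AddCommGroup M] [Module ℂ M] :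
    Submodule ℝ (Module.Dual ℂ M → ℝ) where
  carrier := {y | ∃ (ι : Type) (_ : Fintype ι) (m : ι → M), ∀ φ, |y φ| ≤ ∑ i, ‖φ (m i)‖ ^ 2}
  zero_mem' := ⟨Empty, inferInstance, Empty.elim, fun φ => by simp⟩
  add_mem' := by
    rintro y z ⟨ι, _, m, hm⟩ ⟨κ, _, k, hk⟩
    refine ⟨ι ⊕ κ, inferInstance, Sum.elim m k, fun φ => ?_⟩
    rw [Fintype.sum_sum_type]
    exact (abs_add_le _ _).trans (add_le_add (hm φ) (hk φ))
  smul_mem' := by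
    rintro r y ⟨ι, _, m, hm⟩
    refine ⟨ι, inferInstance, fun i => ((√|r| : ℝ) : ℂ) • m i, fun φ => ?_⟩
    have : ∀ i, ‖φ (((√|r| : ℝ) : ℂ) • m i)‖ ^ 2 = |r| * ‖φ (m i)‖ ^ 2 := fun i => by
      rw [map_smul, norm_smul, mul_pow, Complex.norm_real, Real.norm_eq_abs, sq_abs,
        Real.sq_sqrt (abs_nonneg _)]
    simp only [this, ← Finset.mul_sum, Pi.smul_apply, smul_eq_mul, abs_mul]
    exact mul_le_mul_of_nonneg_left (hm φ) (abs_nonneg _)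

theorem mul_norm_mem_dominatedFunctions {M : Type*} [AddCommGroup M] [Module ℂ M] (a b : M)
    (y : Module.Dual ℂ M → ℝ) (hy : ∀ φ, |y φ| ≤ ‖φ a‖ * ‖φ b‖) : y ∈ dominatedFunctions M :=
  ⟨Fin 2, inferInstance, ![a, b], fun φ => by
    have := hy φ
    simp only [Fin.sum_univ_two, Matrix.cons_val_zero, Matrix.cons_val_one]
    nlinarith [sq_nonneg (‖φ a‖ - ‖φ b‖), sq_nonneg (‖φ a‖ + ‖φ b‖)]⟩

/-- A consistent family `S` of constraints on positive sesquilinear forms, stable under addition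
and positive scaling, and bounding every vector, is satisfied by some form. -/
theorem exists_core_of_consistent {M : Type*} [AddCommGroup M] [Module ℂ M]
    (S : Set ((Module.Dual ℂ M → ℝ) × ℝ))
    (hnonneg : ∀ y t, (∀ φ, 0 ≤ y φ) → 0 ≤ t → (y, t) ∈ S)
    (hadd : ∀ p ∈ S, ∀ q ∈ S, p + q ∈ S)
    (hsmul : ∀ r : ℝ, 0 < r → ∀ p ∈ S, r • p ∈ S)
    (hcons : ∀ t, (0, t) ∈ S → 0 ≤ t)
    (hdom : ∀ m : M, ∃ C : ℝ, ((fun φ => -‖φ m‖ ^ 2), C) ∈ S) :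
    ∃ B : PreInnerProductSpace.Core ℂ M, ∀ (ι κ : Type) (_ : Fintype ι) (_ : Fintype κ)
      (h : ι → M) (k : κ → M) (t : ℝ),
      ((fun φ => ∑ j, ‖φ (k j)‖ ^ 2 - ∑ i, ‖φ (h i)‖ ^ 2), t) ∈ S →
        ∑ i, (B.inner (h i) (h i)).re ≤ ∑ j, (B.inner (k j) (k j)).re + t := by
  classical
  let X := dominatedFunctions M
  let c : PointedCone ℝ (X × ℝ) :=
    { carrier := {p | ((p.1 : Module.Dual ℂ M → ℝ), p.2) ∈ S}
      zero_mem' := hnonneg _ _ (fun _ => le_rfl) le_rfl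
      add_mem' := fun {a b} ha hb => hadd _ ha _ hb
      smul_mem' := fun r p hp => by
        rcases r.2.eq_or_lt with h0 | h0
        · have : r = 0 := Subtype.ext h0.symm
          subst this
          simpa using hnonneg 0 0 (fun _ => le_rfl) le_rfl
        · exact hsmul r h0 _ hp }
  -- A pair `(y, t)` in the cone encodes the demand `G y + t ≥ 0`. The functional is prescribed as
  -- `t` on `(0, t)`: `hcons` is its positivity there, and `hdom` makes this line cofinal, as Riesz
  -- extension requires.
  let D : Submodule ℝ (X × ℝ) := LinearMap.range (LinearMap.inr ℝ X ℝ)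
  let f : (X × ℝ) →ₗ.[ℝ] ℝ := ⟨D, LinearMap.snd ℝ X ℝ ∘ₗ D.subtype⟩
  obtain ⟨g, hgf, hg⟩ := riesz_extension c f
    (by
      rintro ⟨_, t, rfl⟩ hx
      exact hcons t hx)
    (by
      rintro ⟨⟨y, ι, _, m, hm⟩, t⟩
      choose C hC using hdom
      have key : ∀ s : Finset ι, ((fun φ => -∑ i ∈ s, ‖φ (m i)‖ ^ 2), ∑ i ∈ s, C (m i)) ∈ S := by
        intro s
        induction s using Finset.induction_on with
        | empty => exact hnonneg _ _ (fun φ => by simp) (by simp)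
        | insert a s ha ih =>
          convert hadd _ (hC (m a)) _ ih using 1
          ext φ <;> simp [Finset.sum_insert ha]; ring
      refine ⟨⟨(0, (∑ i, C (m i)) - t), (∑ i, C (m i)) - t, rfl⟩, ?_⟩
      change ((((0 : X) + ⟨y, _⟩ : X) : Module.Dual ℂ M → ℝ), (∑ i, C (m i)) - t + t) ∈ S
      have h2 := hadd _ (key Finset.univ) _
        (hnonneg (fun φ => y φ + ∑ i, ‖φ (m i)‖ ^ 2) 0
          (fun φ => by have := hm φ; rw [abs_le] at this; linarith) le_rfl)
      convert h2 using 1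
      ext φ <;> simp)
  -- The complex form is assembled from the values of the real functional on the real and imaginary
  -- parts of `conj (φ a) * φ a'`.
  let b (a a' : M) : X := ⟨fun φ => (starRingEnd ℂ (φ a) * φ a').re,
    mul_norm_mem_dominatedFunctions a a' _ fun φ => by
      refine (Complex.abs_re_le_norm _).trans ?_
      simp⟩
  let d (a a' : M) : X := ⟨fun φ => (starRingEnd ℂ (φ a) * φ a').im,
    mul_norm_mem_dominatedFunctions a a' _ fun φ => by
      refine (Complex.abs_im_le_norm _).trans ?_
      simp⟩
  let G : X →ₗ[ℝ] ℝ := g ∘ₗ LinearMap.inl ℝ X ℝ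
  have hg0 : ∀ t : ℝ, g (0, t) = t := fun t => hgf ⟨(0, t), t, rfl⟩
  have hgG : ∀ (y : X) (t : ℝ), g (y, t) = G y + t := fun y t => by
    have : ((y, t) : X × ℝ) = (y, 0) + (0, t) := by simp
    rw [this, map_add, hg0]; rfl
  have hGS : ∀ (y : X) (t : ℝ), ((y : Module.Dual ℂ M → ℝ), t) ∈ S → 0 ≤ G y + t :=
    fun y t hy => by rw [← hgG]; exact hg _ hy
  have hbsq : ∀ a φ, (b a a : Module.Dual ℂ M → ℝ) φ = ‖φ a‖ ^ 2 := fun a φ => by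
    simp only [b, ← Complex.normSq_eq_conj_mul_self, Complex.ofReal_re, Complex.normSq_eq_norm_sq]
  refine ⟨⟨⟨fun a a' => ⟨G (b a a'), G (d a a')⟩⟩, ?_, ?_, ?_, ?_⟩, ?_⟩
  · intro x y
    have h1 : b y x = b x y := by ext φ; simp [b]; ring
    have h2 : d y x = - d x y := by ext φ; simp [d]; ring
    apply Complex.ext <;> simp [h1, h2]
  · intro x
    have := hGS (b x x) 0 (hnonneg _ _ (fun φ => by rw [hbsq]; positivity) le_rfl)
    simpa using this
  · intro x y z
    have h1 : b (x + y) z = b x z + b y z := by ext φ; simp [b]; ring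
    have h2 : d (x + y) z = d x z + d y z := by ext φ; simp [d]; ring
    apply Complex.ext <;> simp [h1, h2]
  · intro x y r
    have h1 : b (r • x) y = r.re • b x y + r.im • d x y := by ext φ; simp [b, d]; ring
    have h2 : d (r • x) y = r.re • d x y - r.im • b x y := by ext φ; simp [b, d]; ring
    apply Complex.ext <;> simp [h1, h2]
    ring
  · intro ι κ _ _ h k t ht
    have := hGS (∑ j, b (k j) (k j) - ∑ i, b (h i) (h i)) t (by
      convert ht using 2
      ext φ
      simp only [Submodule.coe_sub, Submodule.coe_sum, Pi.sub_apply, Finset.sum_apply, hbsq])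
    simp only [map_sub, map_sum] at this
    change ∑ i, G (b (h i) (h i)) ≤ ∑ j, G (b (k j) (k j)) + t
    linarith

/-- The Hilbert space representation attached to a positive form and a form-bounded action. -/
theorem exists_representation_of_core {M : Type u} [AddCommGroup M] [Module ℂ M]
    (B : PreInnerProductSpace.Core ℂ M) {A : Type*} [Ring A] [Algebra ℂ A]
    (τ : A →ₐ[ℂ] Module.End ℂ M)
    (hτ : ∀ a, ∃ C : ℝ, 0 ≤ C ∧ ∀ m, (B.inner (τ a m) (τ a m)).re ≤ C ^ 2 * (B.inner m m).re) :
    ∃ (K : Type u) (_ : NormedAddCommGroup K) (_ : InnerProductSpace ℂ K) (_ : CompleteSpace K)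
      (j : M →ₗ[ℂ] K) (v : A →ₐ[ℂ] (K →L[ℂ] K)),
      DenseRange j ∧ (∀ m, ‖j m‖ ^ 2 = (B.inner m m).re) ∧ ∀ a m, v a (j m) = j (τ a m) := by
  let : SeminormedAddCommGroup M := InnerProductSpace.Core.toSeminormedAddCommGroup (c := B)
  let : InnerProductSpace ℂ M := InnerProductSpace.ofCore B
  have hn : ∀ m : M, ‖m‖ ^ 2 = (B.inner m m).re := fun m => by
    rw [@norm_sq_eq_re_inner ℂ]; rfl
  choose C hC0 hC using hτ
  let T (a : A) : M →L[ℂ] M := (τ a).mkContinuous (C a) fun m => by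
    rw [← sq_le_sq₀ (norm_nonneg _) (mul_nonneg (hC0 a) (norm_nonneg _)), mul_pow, hn, hn]
    exact hC a m
  let j : M →ₗ[ℂ] UniformSpace.Completion M :=
    (UniformSpace.Completion.toComplL : M →L[ℂ] UniformSpace.Completion M).toLinearMap
  have hj : DenseRange j := UniformSpace.Completion.denseRange_coe
  have hT : ∀ a m, (T a).completion (j m) = j (τ a m) := fun a m =>
    ContinuousLinearMap.completion_apply_coe _ _
  have hext : ∀ P Q : UniformSpace.Completion M →L[ℂ] UniformSpace.Completion M,
      (∀ m, P (j m) = Q (j m)) → P = Q := fun P Q h =>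
    ContinuousLinearMap.coeFn_injective (hj.equalizer P.continuous Q.continuous (funext h))
  refine ⟨UniformSpace.Completion M, inferInstance, inferInstance, inferInstance, j,
    AlgHom.ofLinearMap
      { toFun := fun a => (T a).completion
        map_add' := fun a a' => hext _ _ fun m => by simp [hT]
        map_smul' := fun r a => hext _ _ fun m => by simp [hT] }
      (hext _ _ fun m => by simp [hT])
      (fun a a' => hext _ _ fun m => by simp [hT]), hj, fun m => ?_, hT⟩
  rw [← hn]
  congr 1
  exact UniformSpace.Completion.norm_coe m

/-! ### Transfer functions over an algebra -/

section Act

variable {A : Type*} [Ring A] [Algebra ℂ A] {M : Type*} [AddCommGroup M] [Module ℂ M]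
  {ι κ l : Type*} [Fintype ι] [Fintype κ] [Fintype l]

/-- The action of matrices over `A` on tuples in an `A`-module. -/
def act (τ : A →ₐ[ℂ] Module.End ℂ M) : Matrix κ ι A →ₗ[ℂ] (ι → M) →ₗ[ℂ] (κ → M) :=
  LinearMap.mk₂ ℂ (fun X m j => ∑ i, τ (X j i) (m i))
    (fun X Y m => by ext j; simp [Finset.sum_add_distrib])
    (fun c X m => by ext j; simp [Finset.smul_sum])
    (fun X m m' => by ext j; simp [Finset.sum_add_distrib])
    (fun c X m => by ext j; simp [Finset.smul_sum])

theorem act_apply (τ : A →ₐ[ℂ] Module.End ℂ M) (X : Matrix κ ι A) (m : ι → M) (j : κ) :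
    act τ X m j = ∑ i, τ (X j i) (m i) := rfl

theorem act_mul (τ : A →ₐ[ℂ] Module.End ℂ M) (X : Matrix l κ A) (Y : Matrix κ ι A) (m : ι → M) :
    act τ (X * Y) m = act τ X (act τ Y m) := by
  ext j
  simp only [act_apply, Matrix.mul_apply, map_sum, map_mul, LinearMap.sum_apply, Module.End.mul_apply]
  exact Finset.sum_comm

theorem act_one [DecidableEq ι] (τ : A →ₐ[ℂ] Module.End ℂ M) (m : ι → M) :
    act τ (1 : Matrix ι ι A) m = m := by
  ext j
  rw [act_apply, Finset.sum_eq_single j]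
  · simp
  · intro i _ hij
    simp [Matrix.one_apply_ne hij.symm]
  · simp

variable (A) in
/-- A scalar matrix, as a matrix over `A`. -/
abbrev scal (α : Matrix κ ι ℂ) : Matrix κ ι A := α.map (algebraMap ℂ A)

theorem act_scal (τ : A →ₐ[ℂ] Module.End ℂ M) (α : Matrix κ ι ℂ) (m : ι → M) (j : κ) :
    act τ (scal A α) m j = ∑ i, α j i • m i := by
  simp [act_apply, Module.algebraMap_end_apply]

/-- A homogeneous term of the transfer function with coefficient matrix `α` at `x`. -/
def feedbackTerm [DecidableEq ι] (α : Matrix (ι ⊕ l) (ι ⊕ κ) ℂ) (x : Matrix ι ι A) (k : ℕ) :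
    Matrix l κ A :=
  scal A α.toBlocks₂₁ * x * ((scal A α.toBlocks₁₁ * x) ^ k * scal A α.toBlocks₁₂)

/-- A partial sum of the transfer function with coefficient matrix `α` at `x`. -/
def feedbackSum [DecidableEq ι] (α : Matrix (ι ⊕ l) (ι ⊕ κ) ℂ) (x : Matrix ι ι A) (N : ℕ) :
    Matrix l κ A :=
  scal A α.toBlocks₂₂ + ∑ k ∈ Finset.range N, feedbackTerm α x k

/-- The remainder of the transfer function with coefficient matrix `α` at `x`. -/
def feedbackRem [DecidableEq ι] (α : Matrix (ι ⊕ l) (ι ⊕ κ) ℂ) (x : Matrix ι ι A) (N : ℕ) :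
    Matrix l ι A :=
  scal A α.toBlocks₂₁ * x * (scal A α.toBlocks₁₁ * x) ^ N

/-- The first block row of `hα` reads `h = α₁₁ x h + α₁₂ p`. Substituting it `N` times into the
second row expands the inverse of `1 - α₁₁ x` without assuming that it exists; what is left over is
a remainder acting on `h`. -/
theorem eq_feedback [DecidableEq ι] (τ : A →ₐ[ℂ] Module.End ℂ M) (α : Matrix (ι ⊕ l) (ι ⊕ κ) ℂ)
    (x : Matrix ι ι A) (h : ι → M) (p : κ → M) (q : l → M)
    (hα : ∀ j, Sum.elim h q j = ∑ i, α j i • Sum.elim (act τ x h) p i) (N : ℕ) :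
    q = act τ (feedbackSum α x N) p + act τ (feedbackRem α x N) h := by
  have h1 : h = act τ (scal A α.toBlocks₁₁ * x) h + act τ (scal A α.toBlocks₁₂) p := by
    ext i
    have := hα (Sum.inl i)
    rw [Fintype.sum_sum_type] at this
    rw [Pi.add_apply, act_mul, act_scal, act_scal]
    exact this
  induction N with
  | zero =>
    ext i
    have := hα (Sum.inr i)
    rw [Fintype.sum_sum_type] at this
    have h0 : feedbackSum α x 0 = scal A α.toBlocks₂₂ := by simp [feedbackSum]
    rw [h0, feedbackRem, pow_zero, Matrix.mul_one, Pi.add_apply, act_mul, act_scal, act_scal,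
      add_comm]
    exact this
  | succ N ih =>
    have h2 : act τ (feedbackRem α x N) h
        = act τ (feedbackTerm α x N) p + act τ (feedbackRem α x (N + 1)) h := by
      conv_lhs => rw [h1]
      rw [map_add, ← act_mul, ← act_mul, add_comm]
      congr 3
      · simp only [feedbackRem, feedbackTerm, Matrix.mul_assoc]
      · simp only [feedbackRem, pow_succ, Matrix.mul_assoc]
    rw [h2] at ih
    rw [feedbackSum, Finset.sum_range_succ, ← add_assoc, map_add, LinearMap.add_apply, add_assoc]
    exact ih

end Act

/-! ### Matrix norm bounds and contractivity of transfer functions -/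

/-- A scalar matrix is contractive for the Euclidean norms. -/
def IsContractive {ι κ : Type*} [Fintype ι] [Fintype κ] (α : Matrix κ ι ℂ) : Prop :=
  ∀ z : ι → ℂ, ∑ j, ‖∑ i, α j i * z i‖ ^ 2 ≤ ∑ i, ‖z i‖ ^ 2

/-- In an orthonormal basis of the finite-dimensional span of the `ξ i`, contractivity applies
coordinate by coordinate. -/
theorem IsContractive.sum_sq_le {ι κ : Type*} [Fintype ι] [Fintype κ] {α : Matrix κ ι ℂ}
    (hα : IsContractive α) {E : Type*} [NormedAddCommGroup E] [InnerProductSpace ℂ E] (ξ : ι → E) :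
    ∑ j, ‖∑ i, α j i • ξ i‖ ^ 2 ≤ ∑ i, ‖ξ i‖ ^ 2 := by
  let V : Submodule ℂ E := Submodule.span ℂ (Set.range ξ)
  have : FiniteDimensional ℂ V := FiniteDimensional.span_of_finite ℂ (Set.finite_range ξ)
  let ζ : ι → V := fun i => ⟨ξ i, Submodule.subset_span ⟨i, rfl⟩⟩
  let b := stdOrthonormalBasis ℂ V
  have h1 : ∀ i, ‖ξ i‖ ^ 2 = ∑ s, ‖inner ℂ (b s) (ζ i)‖ ^ 2 := fun i =>
    (b.sum_sq_norm_inner_right (ζ i)).symm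
  have h2 : ∀ j, ‖∑ i, α j i • ξ i‖ ^ 2 = ∑ s, ‖∑ i, α j i * inner ℂ (b s) (ζ i)‖ ^ 2 := fun j => by
    have : ∑ i, α j i • ξ i = ((∑ i, α j i • ζ i : V) : E) := by simp [ζ]
    have h3 := b.sum_sq_norm_inner_right (∑ i, α j i • ζ i)
    simp only [inner_sum, inner_smul_right] at h3
    rw [this, h3]
    rfl
  simp only [h1, h2]
  rw [Finset.sum_comm, Finset.sum_comm (γ := ι)]
  exact Finset.sum_le_sum fun s _ => hα _

section Bounded

variable {A : Type*} [Ring A] [Algebra ℂ A] {E : Type*} [NormedAddCommGroup E]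
  [InnerProductSpace ℂ E] {ι κ l : Type*} [Fintype ι] [Fintype κ] [Fintype l]

/-- The action on vectors of a homomorphism into bounded operators. -/
def vecAct (v : A →ₐ[ℂ] (E →L[ℂ] E)) : A →ₐ[ℂ] Module.End ℂ E :=
  AlgHom.ofLinearMap
    { toFun := fun a => (v a : E →ₗ[ℂ] E)
      map_add' := fun a b => by ext; simp
      map_smul' := fun c a => by ext; simp }
    (by ext; simp) (fun a b => by ext; simp)

@[simp]
theorem vecAct_apply (v : A →ₐ[ℂ] (E →L[ℂ] E)) (a : A) (m : E) : vecAct v a m = v a m := rfl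

/-- The matrix `(v x_ij)` has operator norm at most `r`. -/
def MatBdd (v : A →ₐ[ℂ] (E →L[ℂ] E)) (X : Matrix κ ι A) (r : ℝ) : Prop :=
  ∀ ξ : ι → E, ‖WithLp.toLp 2 (act (vecAct v) X ξ)‖ ≤ r * ‖WithLp.toLp 2 ξ‖

variable {v : A →ₐ[ℂ] (E →L[ℂ] E)}

theorem MatBdd.mono {X : Matrix κ ι A} {r s : ℝ} (h : MatBdd v X r) (hrs : r ≤ s) :
    MatBdd v X s := fun ξ => (h ξ).trans (mul_le_mul_of_nonneg_right hrs (norm_nonneg _))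

theorem MatBdd.mul {X : Matrix l κ A} {Y : Matrix κ ι A} {r s : ℝ} (hr : 0 ≤ r)
    (hX : MatBdd v X r) (hY : MatBdd v Y s) : MatBdd v (X * Y) (r * s) := fun ξ => by
  rw [act_mul, mul_assoc]
  exact (hX _).trans (mul_le_mul_of_nonneg_left (hY ξ) hr)

theorem MatBdd.add {X Y : Matrix κ ι A} {r s : ℝ}
    (hX : MatBdd v X r) (hY : MatBdd v Y s) : MatBdd v (X + Y) (r + s) := fun ξ => by
  rw [map_add, LinearMap.add_apply, WithLp.toLp_add, add_mul]
  exact (norm_add_le _ _).trans (add_le_add (hX ξ) (hY ξ))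

theorem MatBdd.smul {X : Matrix κ ι A} {r : ℝ} (hX : MatBdd v X r) (c : ℂ) :
    MatBdd v (c • X) (‖c‖ * r) := fun ξ => by
  rw [map_smul, LinearMap.smul_apply, WithLp.toLp_smul, norm_smul, mul_assoc]
  exact mul_le_mul_of_nonneg_left (hX ξ) (norm_nonneg _)

theorem MatBdd.zero : MatBdd v (0 : Matrix κ ι A) 0 := fun ξ => by simp

theorem MatBdd.sum {s : Type*} (t : Finset s) {X : s → Matrix κ ι A} {r : s → ℝ}
    (h : ∀ i ∈ t, MatBdd v (X i) (r i)) : MatBdd v (∑ i ∈ t, X i) (∑ i ∈ t, r i) := by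
  classical
  induction t using Finset.induction_on with
  | empty => simpa using MatBdd.zero
  | insert a t ha ih =>
    rw [Finset.sum_insert ha, Finset.sum_insert ha]
    exact (h a (by simp)).add (ih fun i hi => h i (by simp [hi]))

theorem MatBdd.pow [DecidableEq ι] {X : Matrix ι ι A} {r : ℝ} (hr : 0 ≤ r)
    (hX : MatBdd v X r) (k : ℕ) : MatBdd v (X ^ k) (r ^ k) := by
  induction k with
  | zero => intro ξ; simp [act_one]
  | succ k ih => rw [pow_succ, pow_succ]; exact ih.mul (by positivity) hX

theorem matBdd_iff {X : Matrix κ ι A} {r : ℝ} (hr : 0 ≤ r) :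
    MatBdd v X r ↔ ∀ ξ : ι → E, ∑ j, ‖∑ i, v (X j i) (ξ i)‖ ^ 2 ≤ r ^ 2 * ∑ i, ‖ξ i‖ ^ 2 := by
  refine forall_congr' fun ξ => ?_
  rw [← sq_le_sq₀ (norm_nonneg _) (by positivity), mul_pow, PiLp.norm_sq_eq_of_L2,
    PiLp.norm_sq_eq_of_L2]
  rfl

theorem IsContractive.matBdd {α : Matrix κ ι ℂ} (hα : IsContractive α)
    (v : A →ₐ[ℂ] (E →L[ℂ] E)) : MatBdd v (scal A α) 1 := by
  rw [matBdd_iff zero_le_one]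
  intro ξ
  simpa using hα.sum_sq_le ξ

/-- A crude size-dependent bound. It turns entrywise approximation into norm approximation and gives
the finite starting value that the halving argument later improves. -/
theorem matBdd_of_entries {X : Matrix κ ι A} {δ : ℝ} (hδ : ∀ j i, ‖v (X j i)‖ ≤ δ) :
    MatBdd v X (Fintype.card κ * Fintype.card ι * δ) := fun ξ => by
  classical
  have h1 : ∀ j, ‖∑ i, v (X j i) (ξ i)‖ ≤ Fintype.card ι * δ * ‖WithLp.toLp 2 ξ‖ := fun j => by
    refine (norm_sum_le _ _).trans ?_
    rw [mul_assoc, ← nsmul_eq_mul, ← Finset.card_univ, ← Finset.sum_const]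
    refine Finset.sum_le_sum fun i _ => ((v (X j i)).le_opNorm _).trans ?_
    exact mul_le_mul (hδ j i) (PiLp.norm_apply_le (WithLp.toLp 2 ξ) i) (norm_nonneg _)
      ((norm_nonneg _).trans (hδ j i))
  have h2 : (WithLp.toLp 2 (act (vecAct v) X ξ)) =
      ∑ j, PiLp.single 2 j (act (vecAct v) X ξ j) := by
    ext j; simp [Finset.sum_apply, Pi.single_apply]
  rw [h2]
  refine (norm_sum_le _ _).trans ?_
  rw [mul_assoc, mul_assoc, ← nsmul_eq_mul, ← Finset.card_univ, ← Finset.sum_const]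
  refine Finset.sum_le_sum fun j _ => ?_
  rw [PiLp.norm_single, ← mul_assoc]
  exact h1 j

theorem MatBdd.entry {X : Matrix κ ι A} {r : ℝ} (hX : MatBdd v X r) (hr : 0 ≤ r) (j : κ) (i : ι) :
    ‖v (X j i)‖ ≤ r := by
  classical
  refine ContinuousLinearMap.opNorm_le_bound _ hr fun e => ?_
  have h1 := hX (Pi.single i e)
  have h2 := (PiLp.norm_apply_le (WithLp.toLp 2 (act (vecAct v) X (Pi.single i e))) j).trans h1
  have h0 : ‖WithLp.toLp 2 (Pi.single i e : ι → E)‖ = ‖e‖ := PiLp.norm_single 2 (fun _ => E) i e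
  rw [h0] at h2
  refine le_trans (le_of_eq ?_) h2
  congr 1
  change _ = act (vecAct v) X (Pi.single i e) j
  rw [act_apply, Finset.sum_eq_single i]
  · simp
  · intro s _ hs; simp [Pi.single_eq_of_ne hs]
  · simp

theorem IsContractive.toBlocks {ι₁ ι₂ κ₁ κ₂ : Type*} [Fintype ι₁] [Fintype ι₂] [Fintype κ₁]
    [Fintype κ₂] {α : Matrix (κ₁ ⊕ κ₂) (ι₁ ⊕ ι₂) ℂ} (hα : IsContractive α) :
    IsContractive α.toBlocks₁₁ ∧ IsContractive α.toBlocks₁₂ ∧ IsContractive α.toBlocks₂₁ ∧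
      IsContractive α.toBlocks₂₂ := by
  refine ⟨fun z => ?_, fun z => ?_, fun z => ?_, fun z => ?_⟩
  · have := hα (Sum.elim z 0)
    simp only [Fintype.sum_sum_type, Sum.elim_inl, Sum.elim_inr, Pi.zero_apply, mul_zero,
      Finset.sum_const_zero, add_zero, norm_zero, ne_eq, OfNat.ofNat_ne_zero, not_false_eq_true,
      zero_pow] at this
    exact (le_add_of_nonneg_right (by positivity)).trans this
  · have := hα (Sum.elim 0 z)
    simp only [Fintype.sum_sum_type, Sum.elim_inl, Sum.elim_inr, Pi.zero_apply, mul_zero,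
      Finset.sum_const_zero, zero_add, norm_zero, ne_eq, OfNat.ofNat_ne_zero, not_false_eq_true,
      zero_pow] at this
    exact (le_add_of_nonneg_right (by positivity)).trans this
  · have := hα (Sum.elim z 0)
    simp only [Fintype.sum_sum_type, Sum.elim_inl, Sum.elim_inr, Pi.zero_apply, mul_zero,
      Finset.sum_const_zero, add_zero, norm_zero, ne_eq, OfNat.ofNat_ne_zero, not_false_eq_true,
      zero_pow] at this
    exact (le_add_of_nonneg_left (by positivity)).trans this
  · have := hα (Sum.elim 0 z)
    simp only [Fintype.sum_sum_type, Sum.elim_inl, Sum.elim_inr, Pi.zero_apply, mul_zero,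
      Finset.sum_const_zero, zero_add, norm_zero, ne_eq, OfNat.ofNat_ne_zero, not_false_eq_true,
      zero_pow] at this
    exact (le_add_of_nonneg_left (by positivity)).trans this

theorem feedbackTerm_matBdd [DecidableEq ι] {α : Matrix (ι ⊕ l) (ι ⊕ κ) ℂ} (hα : IsContractive α)
    {x : Matrix ι ι A} {r : ℝ} (hr : 0 ≤ r) (hx : MatBdd v x r) (k : ℕ) :
    MatBdd v (feedbackTerm α x k) (r ^ (k + 1)) := by
  obtain ⟨h11, h12, h21, -⟩ := hα.toBlocks
  have h1 := (((h21.matBdd v).mul zero_le_one hx).mul (by positivity)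
    (((((h11.matBdd v).mul zero_le_one hx).pow (by positivity) k)).mul (by positivity)
      (h12.matBdd v)))
  exact h1.mono (le_of_eq (by ring))

theorem feedbackRem_matBdd [DecidableEq ι] {α : Matrix (ι ⊕ l) (ι ⊕ κ) ℂ} (hα : IsContractive α)
    {x : Matrix ι ι A} {r : ℝ} (hr : 0 ≤ r) (hx : MatBdd v x r) (k : ℕ) :
    MatBdd v (feedbackRem α x k) (r ^ (k + 1)) := by
  obtain ⟨h11, h12, h21, -⟩ := hα.toBlocks
  have h1 := (((h21.matBdd v).mul zero_le_one hx).mul (by positivity)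
    ((((h11.matBdd v).mul zero_le_one hx).pow (by positivity) k)))
  exact h1.mono (le_of_eq (by ring))

/-- The Cesàro means of the transfer function are contractive at contractive matrices. -/
theorem feedbackSum_mean_matBdd [DecidableEq ι] {α : Matrix (ι ⊕ l) (ι ⊕ κ) ℂ}
    (hα : IsContractive α) {x : Matrix ι ι A} (hx : MatBdd v x 1) {T : ℕ} (hT : 0 < T) :
    MatBdd v ((T : ℂ)⁻¹ • ∑ N ∈ Finset.range T, feedbackSum α x N) 1 := fun ξ => by
  let Y (N : ℕ) : Matrix ι κ A :=
    ∑ k ∈ Finset.range N, (scal A α.toBlocks₁₁ * x) ^ k * scal A α.toBlocks₁₂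
  let η (N : ℕ) := act (vecAct v) (Y N) ξ
  let w (N : ℕ) := act (vecAct v) (feedbackSum α x N) ξ
  have hY : ∀ N, Y (N + 1) = scal A α.toBlocks₁₁ * x * Y N + scal A α.toBlocks₁₂ := fun N => by
    simp only [Y, Finset.sum_range_succ', pow_zero, Matrix.one_mul, Matrix.mul_sum]
    congr 1
    exact Finset.sum_congr rfl fun k _ => by rw [pow_succ', Matrix.mul_assoc]
  have hS : ∀ N, feedbackSum α x N = scal A α.toBlocks₂₁ * x * Y N + scal A α.toBlocks₂₂ := fun N => by
    simp only [feedbackSum, feedbackTerm, Y, Matrix.mul_sum, add_comm]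
  -- Energy balance of the feedback loop: α sends `(x η_N, ξ)` to `(η_{N+1}, w_N)`, and both α and
  -- `x` are contractive.
  have step : ∀ N, ‖WithLp.toLp 2 (w N)‖ ^ 2 + ‖WithLp.toLp 2 (η (N + 1))‖ ^ 2 ≤
      ‖WithLp.toLp 2 (η N)‖ ^ 2 + ‖WithLp.toLp 2 ξ‖ ^ 2 := fun N => by
    have h1 := hα.sum_sq_le (Sum.elim (act (vecAct v) x (η N)) ξ)
    have h2 : ∀ i, η (N + 1) i = ∑ s, α (Sum.inl i) s • Sum.elim (act (vecAct v) x (η N)) ξ s := by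
      intro i
      simp only [η, hY, map_add, LinearMap.add_apply, Pi.add_apply, act_mul, act_scal,
        Fintype.sum_sum_type, Sum.elim_inl, Sum.elim_inr]
      rfl
    have h3 : ∀ i, w N i = ∑ s, α (Sum.inr i) s • Sum.elim (act (vecAct v) x (η N)) ξ s := by
      intro i
      simp only [w, η, hS, map_add, LinearMap.add_apply, Pi.add_apply, act_mul, act_scal,
        Fintype.sum_sum_type, Sum.elim_inl, Sum.elim_inr]
      rfl
    rw [Fintype.sum_sum_type, Fintype.sum_sum_type] at h1
    simp only [← h2, ← h3, Sum.elim_inl, Sum.elim_inr] at h1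
    have h4 := hx (η N)
    rw [one_mul, ← sq_le_sq₀ (norm_nonneg _) (norm_nonneg _)] at h4
    simp only [PiLp.norm_sq_eq_of_L2] at h4 ⊢
    linarith
  -- Summed from `η 0 = 0`, this controls the outputs only in quadratic mean, which is why Cesàro
  -- means are used.
  have tele : ∀ n, ∑ N ∈ Finset.range n, ‖WithLp.toLp 2 (w N)‖ ^ 2 + ‖WithLp.toLp 2 (η n)‖ ^ 2 ≤
      n * ‖WithLp.toLp 2 ξ‖ ^ 2 := fun n => by
    induction n with
    | zero => simp [η, Y]
    | succ n ih =>
      rw [Finset.sum_range_succ]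
      push_cast
      linarith [step n]
  have hT' : (0 : ℝ) < T := by exact_mod_cast hT
  have h5 : WithLp.toLp 2 (act (vecAct v) ((T : ℂ)⁻¹ • ∑ N ∈ Finset.range T, feedbackSum α x N) ξ)
      = (T : ℂ)⁻¹ • ∑ N ∈ Finset.range T, WithLp.toLp 2 (w N) := by
    rw [map_smul, map_sum, LinearMap.smul_apply, LinearMap.sum_apply, WithLp.toLp_smul,
      WithLp.toLp_sum]
  rw [h5, norm_smul, norm_inv, Complex.norm_natCast, one_mul, inv_mul_le_iff₀ hT']
  refine (norm_sum_le _ _).trans ?_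
  have h6 := sq_sum_le_card_mul_sum_sq (s := Finset.range T) (f := fun N => ‖WithLp.toLp 2 (w N)‖)
  rw [Finset.card_range] at h6
  refine abs_le_of_sq_le_sq' ?_ (by positivity) |>.2
  have h7 : ∑ N ∈ Finset.range T, ‖WithLp.toLp 2 (w N)‖ ^ 2 ≤ T * ‖WithLp.toLp 2 ξ‖ ^ 2 :=
    (le_add_of_nonneg_right (by positivity)).trans (tele T)
  calc _ ≤ _ := h6
    _ ≤ T * (T * ‖WithLp.toLp 2 ξ‖ ^ 2) := mul_le_mul_of_nonneg_left h7 hT'.le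
    _ = _ := by ring

end Bounded

/-! ### Operator and cb norms as matrix bounds -/

section Norms

variable {H₀ H : Type u} [NormedAddCommGroup H₀] [InnerProductSpace ℂ H₀]
  [NormedAddCommGroup H] [InnerProductSpace ℂ H] {A : Subalgebra ℂ (H₀ →L[ℂ] H₀)}

theorem norm_matOp_map_le_iff {E : Type u} [NormedAddCommGroup E] [InnerProductSpace ℂ E]
    (v : A →ₐ[ℂ] (E →L[ℂ] E)) {n : ℕ} (x : Matrix (Fin n) (Fin n) A) {r : ℝ} (hr : 0 ≤ r) :
    ‖matOp (x.map v)‖ ≤ r ↔ MatBdd v x r := by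
  rw [ContinuousLinearMap.opNorm_le_iff hr]
  have : ∀ ξ : Fin n → E, matOp (x.map v) (WithLp.toLp 2 ξ) =
      WithLp.toLp 2 (act (vecAct v) x ξ) := fun ξ => by
    ext i; simp [matOp_apply, act_apply]
  exact ⟨fun h ξ => by rw [← this]; exact h _, fun h ξ => by
    have := this ξ.ofLp
    rw [WithLp.toLp_ofLp] at this
    rw [this]; exact h _⟩

theorem norm_matOp_val_le_iff {n : ℕ} (x : Matrix (Fin n) (Fin n) A) {r : ℝ} (hr : 0 ≤ r) :
    ‖matOp (x.map fun a => (a : H₀ →L[ℂ] H₀))‖ ≤ r ↔ MatBdd A.val x r :=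
  norm_matOp_map_le_iff A.val x hr

theorem opNorm_le_iff (v : A →ₐ[ℂ] (H →L[ℂ] H)) {C : ℝ} (hC : 0 ≤ C) :
    opNorm v ≤ ENNReal.ofReal C ↔ ∀ a : A, ‖v a‖ ≤ C * ‖(a : H₀ →L[ℂ] H₀)‖ := by
  simp only [opNorm, iSup_le_iff]
  have key : ∀ a : A, ‖v a‖ₑ ≤ ENNReal.ofReal C ↔ ‖v a‖ ≤ C := fun a => by
    rw [← ofReal_norm, ENNReal.ofReal_le_ofReal_iff hC]
  simp only [key]
  constructor
  · intro h a
    by_cases ha : ‖(a : H₀ →L[ℂ] H₀)‖ = 0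
    · have : a = 0 := Subtype.ext (norm_eq_zero.1 ha)
      simp [this]
    · have h1 := h (((‖(a : H₀ →L[ℂ] H₀)‖⁻¹ : ℝ) : ℂ) • a) (by
        simp only [SetLike.val_smul, norm_smul, Complex.norm_real, norm_inv, norm_norm]
        rw [inv_mul_cancel₀ ha])
      rw [map_smul, norm_smul, Complex.norm_real, norm_inv, norm_norm,
        inv_mul_le_iff₀ (lt_of_le_of_ne (norm_nonneg _) (Ne.symm ha))] at h1
      linarith
  · intro h a ha
    exact (h a).trans (mul_le_of_le_one_right hC ha)

theorem cbNorm_le_iff (v : A →ₐ[ℂ] (H →L[ℂ] H)) {K : ℝ} (hK : 0 ≤ K) :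
    cbNorm v ≤ ENNReal.ofReal K ↔
      ∀ (n : ℕ) (x : Matrix (Fin n) (Fin n) A), MatBdd A.val x 1 → MatBdd v x K := by
  simp only [cbNorm, iSup_le_iff]
  refine forall_congr' fun n => forall_congr' fun x => ?_
  rw [norm_matOp_val_le_iff x zero_le_one, ← ofReal_norm,
    ENNReal.ofReal_le_ofReal_iff hK, norm_matOp_map_le_iff v x hK]

theorem MatBdd.of_scaled {A' E : Type*} [Ring A'] [Algebra ℂ A'] [NormedAddCommGroup E]
    [InnerProductSpace ℂ E] {v : A' →ₐ[ℂ] (E →L[ℂ] E)} {ι κ : Type*} [Fintype ι] [Fintype κ]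
    {X : Matrix κ ι A'} {t K : ℝ} (ht : 0 < t) (h : MatBdd v (((t⁻¹ : ℝ) : ℂ) • X) K) :
    MatBdd v X (K * t) := by
  have := h.smul (t : ℂ)
  rw [smul_smul, ← Complex.ofReal_mul, mul_inv_cancel₀ ht.ne', Complex.ofReal_one, one_smul,
    Complex.norm_real, Real.norm_of_nonneg ht.le, mul_comm] at this
  exact this

/-- A completely bounded homomorphism is bounded on rectangular matrices of any size. -/
theorem matBdd_of_cbNorm_le {v : A →ₐ[ℂ] (H →L[ℂ] H)} {K : ℝ} (hK : 0 ≤ K)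
    (hv : cbNorm v ≤ ENNReal.ofReal K) {ι κ : Type*} [Fintype ι] [Fintype κ]
    {X : Matrix κ ι A} {r : ℝ} (hr : 0 ≤ r) (hX : MatBdd A.val X r) : MatBdd v X (K * r) := by
  classical
  rw [cbNorm_le_iff v hK] at hv
  let e : Fin (Fintype.card (κ ⊕ ι)) ≃ κ ⊕ ι := (Fintype.equivFin _).symm
  -- Padding with zero blocks makes the matrix square without changing its norm.
  let Z : Matrix (κ ⊕ ι) (κ ⊕ ι) A := Matrix.fromBlocks 0 X 0 0
  have hZ : ∀ {E : Type u} [NormedAddCommGroup E] [InnerProductSpace ℂ E]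
      (w : A →ₐ[ℂ] (E →L[ℂ] E)) (s : ℝ), 0 ≤ s →
      (MatBdd w (Z.submatrix e e) s ↔ MatBdd w X s) := fun w s hs => by
    rw [matBdd_iff hs, matBdd_iff hs]
    have hsum : ∀ ξ : Fin (Fintype.card (κ ⊕ ι)) → _, ∑ j, ‖∑ i, w (Z.submatrix e e j i) (ξ i)‖ ^ 2
        = ∑ j, ‖∑ i, w (X j i) (ξ (e.symm (Sum.inr i)))‖ ^ 2 := fun ξ => by
      rw [← e.symm.sum_comp, Fintype.sum_sum_type]
      have : ∀ j, ∑ i, w (Z.submatrix e e (e.symm j) i) (ξ i)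
          = ∑ i, w (Z j i) (ξ (e.symm i)) := fun j => by
        rw [← e.symm.sum_comp]; simp
      simp only [this]
      simp [Z, Fintype.sum_sum_type]
    constructor
    · intro h ξ
      have h1 := h fun i => Sum.elim 0 ξ (e i)
      rw [hsum, e.sum_comp (fun i => ‖Sum.elim 0 ξ i‖ ^ 2), Fintype.sum_sum_type] at h1
      simpa using h1
    · intro h ξ
      rw [hsum]
      refine (h _).trans (mul_le_mul_of_nonneg_left ?_ (by positivity))
      rw [← e.symm.sum_comp (fun i => ‖ξ i‖ ^ 2), Fintype.sum_sum_type]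
      exact le_add_of_nonneg_left (by positivity)
  -- Normalising by `t > r` avoids division by zero when `r = 0`; then `t` tends to `r`.
  have main : ∀ t, r < t → MatBdd v X (K * t) := fun t ht => by
    have ht0 : 0 < t := hr.trans_lt ht
    have h1 : MatBdd A.val (((t⁻¹ : ℝ) : ℂ) • Z.submatrix e e) 1 := by
      refine (((hZ A.val r hr).2 hX).smul _).mono ?_
      rw [Complex.norm_real, Real.norm_of_nonneg (by positivity), inv_mul_le_iff₀ ht0]
      linarith
    exact (hZ v _ (by positivity)).1 (MatBdd.of_scaled ht0 (hv _ _ h1))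
  intro ξ
  refine le_of_forall_gt_imp_ge_of_dense fun b hb => ?_
  have hc : Filter.Tendsto (fun t => K * t * ‖WithLp.toLp 2 ξ‖) (nhdsWithin r (Set.Ioi r))
      (nhds (K * r * ‖WithLp.toLp 2 ξ‖)) :=
    (Continuous.tendsto (by fun_prop) r).mono_left nhdsWithin_le_nhds
  obtain ⟨t, ht1, ht2⟩ := ((hc.eventually_lt_const hb).and self_mem_nhdsWithin).exists
  exact (main t ht2 ξ).trans ht1.le

end Norms

/-! ### Completely bounded homomorphisms and similarity -/

theorem exists_hilbert_space_of_core {M : Type u} [AddCommGroup M] [Module ℂ M]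
    (B : PreInnerProductSpace.Core ℂ M) :
    ∃ (K : Type u) (_ : NormedAddCommGroup K) (_ : InnerProductSpace ℂ K) (_ : CompleteSpace K)
      (j : M →ₗ[ℂ] K), ∀ m, ‖j m‖ ^ 2 = (B.inner m m).re := by
  let : SeminormedAddCommGroup M := InnerProductSpace.Core.toSeminormedAddCommGroup (c := B)
  let : InnerProductSpace ℂ M := InnerProductSpace.ofCore B
  refine ⟨UniformSpace.Completion M, inferInstance, inferInstance, inferInstance,
    (UniformSpace.Completion.toComplL : M →L[ℂ] UniformSpace.Completion M).toLinearMap,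
    fun m => ?_⟩
  have h1 : ‖m‖ ^ 2 = (B.inner m m).re := by rw [@norm_sq_eq_re_inner ℂ]; rfl
  rw [← h1]
  congr 1
  exact UniformSpace.Completion.norm_coe m

/-- A bounded and bounded below positive form on a Hilbert space is `‖T ·‖²`, `T` invertible. -/
theorem exists_unit_of_core {H : Type u} [NormedAddCommGroup H] [InnerProductSpace ℂ H]
    [CompleteSpace H] (B : PreInnerProductSpace.Core ℂ H) (C : ℝ)
    (hC : ∀ m, (B.inner m m).re ≤ C ^ 2 * ‖m‖ ^ 2) (hB : ∀ m, ‖m‖ ^ 2 ≤ (B.inner m m).re) :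
    ∃ T : (H →L[ℂ] H)ˣ, ∀ m, ‖(T : H →L[ℂ] H) m‖ ^ 2 = (B.inner m m).re := by
  obtain ⟨K, _, _, _, j₀, hj₀⟩ := exists_hilbert_space_of_core B
  let j : H →L[ℂ] K := j₀.mkContinuous |C| fun m => by
    rw [← sq_le_sq₀ (norm_nonneg _) (by positivity), mul_pow, hj₀, sq_abs]
    exact hC m
  have hj : ∀ m, ‖j m‖ ^ 2 = (B.inner m m).re := hj₀
  let G : H →L[ℂ] H := j.adjoint ∘L j
  have hG : 0 ≤ G := by
    rw [ContinuousLinearMap.nonneg_iff_isPositive]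
    exact ContinuousLinearMap.isPositive_adjoint_comp_self j
  have hGm : ∀ m, inner ℂ (G m) m = ((‖j m‖ ^ 2 : ℝ) : ℂ) := fun m => by
    simp only [G, ContinuousLinearMap.comp_apply, ContinuousLinearMap.adjoint_inner_left]
    simp [inner_self_eq_norm_sq_to_K]
  -- The lower bound `hB` makes `G` coercive, hence invertible; its square root represents the form
  -- on `H` itself.
  have hunit : IsUnit G := by
    refine ContinuousLinearMap.isUnit_of_forall_le_norm_inner_map G (c := 1) one_pos fun m => ?_
    rw [hGm, Complex.norm_real, Real.norm_of_nonneg (by positivity), hj]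
    simpa using hB m
  let R := CFC.sqrt G
  have hR : IsUnit R := (CFC.isUnit_sqrt_iff G hG).2 hunit
  refine ⟨hR.unit, fun m => ?_⟩
  have hRs : IsSelfAdjoint R := (CFC.sqrt_nonneg G).isSelfAdjoint
  have h1 : inner ℂ (R m) (R m) = inner ℂ (G m) m := by
    have h2 : R * R = G := CFC.sqrt_mul_sqrt_self G hG
    have h3 : R.adjoint = R := hRs.adjoint_eq
    conv_rhs => rw [← h2]
    rw [mul_apply_eq_comp]
    conv_rhs => rw [← ContinuousLinearMap.adjoint_inner_right, h3]
  rw [hGm, inner_self_eq_norm_sq_to_K] at h1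
  rw [← hj]
  change ‖R m‖ ^ 2 = _
  exact Complex.ofReal_injective ((Complex.ofReal_pow _ _).trans h1)

theorem norm_toLp_sq {ι E : Type*} [Fintype ι] [NormedAddCommGroup E] (ξ : ι → E) :
    ‖WithLp.toLp 2 ξ‖ ^ 2 = ∑ i, ‖ξ i‖ ^ 2 := PiLp.norm_sq_eq_of_L2 _ _

theorem MatBdd.fromBlocks_diagonal {A : Type*} [Ring A] [Algebra ℂ A] {E : Type*}
    [NormedAddCommGroup E] [InnerProductSpace ℂ E] {v : A →ₐ[ℂ] (E →L[ℂ] E)}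
    {ι κ : Type*} [Fintype ι] [Fintype κ] {x : Matrix ι ι A} {y : Matrix κ κ A} {r : ℝ}
    (hr : 0 ≤ r) (hx : MatBdd v x r) (hy : MatBdd v y r) :
    MatBdd v (Matrix.fromBlocks x 0 0 y) r := by
  rw [matBdd_iff hr] at hx hy ⊢
  intro ξ
  simp only [Fintype.sum_sum_type, Matrix.fromBlocks_apply₁₁, Matrix.fromBlocks_apply₁₂,
    Matrix.fromBlocks_apply₂₁, Matrix.fromBlocks_apply₂₂, Matrix.zero_apply, map_zero,
    zero_apply, Finset.sum_const_zero, add_zero, zero_add, mul_add]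
  exact add_le_add (hx _) (hy _)

theorem act_fromBlocks_diagonal {A : Type*} [Ring A] [Algebra ℂ A] {M : Type*} [AddCommGroup M]
    [Module ℂ M] (τ : A →ₐ[ℂ] Module.End ℂ M) {ι κ : Type*} [Fintype ι] [Fintype κ]
    (x : Matrix ι ι A) (y : Matrix κ κ A) (h : ι → M) (k : κ → M) :
    act τ (Matrix.fromBlocks x 0 0 y) (Sum.elim h k) = Sum.elim (act τ x h) (act τ y k) := by
  ext (i | i) <;> simp [act_apply, Fintype.sum_sum_type]

theorem sum_norm_sq_dual_smul {M ι : Type*} [AddCommGroup M] [Module ℂ M] [Fintype ι] {r : ℝ}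
    (hr : 0 ≤ r) (h : ι → M) (φ : Module.Dual ℂ M) :
    ∑ i, ‖φ ((((√r : ℝ) : ℂ) • h) i)‖ ^ 2 = r * ∑ i, ‖φ (h i)‖ ^ 2 := by
  rw [Finset.mul_sum]
  exact Finset.sum_congr rfl fun i _ => by
    rw [Pi.smul_apply, map_smul, norm_smul, mul_pow, Complex.norm_real, Real.norm_eq_abs, sq_abs,
      Real.sq_sqrt hr]

section Similarity

variable {H₀ H : Type u} [NormedAddCommGroup H₀] [InnerProductSpace ℂ H₀]
  [NormedAddCommGroup H] [InnerProductSpace ℂ H] {A : Subalgebra ℂ (H₀ →L[ℂ] H₀)}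

/-- Feedback estimate for completely bounded homomorphisms. -/
theorem norm_le_of_feedback {v : A →ₐ[ℂ] (H →L[ℂ] H)} {K : ℝ} (hK : 0 ≤ K)
    (hv : cbNorm v ≤ ENNReal.ofReal K) {ι κ l : Type*} [Fintype ι] [Fintype κ] [Fintype l]
    {x : Matrix ι ι A} {ρ : ℝ} (hρ0 : 0 ≤ ρ) (hρ : ρ < 1) (hx : MatBdd A.val x ρ)
    (h : ι → H) (p : κ → H) (q : l → H)
    (hle : ∀ φ : Module.Dual ℂ H, ∑ i, ‖φ (h i)‖ ^ 2 + ∑ i, ‖φ (q i)‖ ^ 2 ≤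
      ∑ i, ‖φ (act (vecAct v) x h i)‖ ^ 2 + ∑ i, ‖φ (p i)‖ ^ 2) :
    ‖WithLp.toLp 2 q‖ ≤ K * ‖WithLp.toLp 2 p‖ := by
  classical
  obtain ⟨α, hα, hα'⟩ := exists_contractive_matrix_of_dual_sum_le
    (Sum.elim (act (vecAct v) x h) p) (Sum.elim h q)
    (fun φ => by simpa [Fintype.sum_sum_type] using hle φ)
  replace hα : IsContractive α := hα
  have hfb := eq_feedback (vecAct v) α x h p q hα'
  -- Averaging the feedback identities over `N < T` gives a contractive coefficient of `p`. Since `ρ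
  -- < 1`, the remainders are summable and their mean is `O(1 / T)`.
  have key : ∀ T : ℕ, 0 < T → ‖WithLp.toLp 2 q‖ ≤
      K * ‖WithLp.toLp 2 p‖ + (T : ℝ)⁻¹ * (K * (1 - ρ)⁻¹ * ‖WithLp.toLp 2 h‖) := by
    intro T hT
    have hT' : (T : ℂ) ≠ 0 := by exact_mod_cast hT.ne'
    have h1 : q = act (vecAct v) ((T : ℂ)⁻¹ • ∑ N ∈ Finset.range T, feedbackSum α x N) p +
        (T : ℂ)⁻¹ • ∑ N ∈ Finset.range T, act (vecAct v) (feedbackRem α x N) h := by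
      have h2 : (T : ℂ)⁻¹ • ∑ N ∈ Finset.range T, q = q := by
        rw [Finset.sum_const, Finset.card_range, ← Nat.cast_smul_eq_nsmul ℂ, smul_smul,
          inv_mul_cancel₀ hT', one_smul]
      conv_lhs => rw [← h2, Finset.sum_congr rfl fun N _ => hfb N]
      rw [Finset.sum_add_distrib, smul_add, map_smul, LinearMap.smul_apply, map_sum,
        LinearMap.sum_apply]
    have h3 := matBdd_of_cbNorm_le hK hv zero_le_one
      (feedbackSum_mean_matBdd hα (hx.mono hρ.le) hT) p
    have h4 : ∀ N, ‖WithLp.toLp 2 (act (vecAct v) (feedbackRem α x N) h)‖ ≤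
        ρ ^ N * (K * ‖WithLp.toLp 2 h‖) := fun N => by
      have h5 : ρ ^ (N + 1) ≤ ρ ^ N := pow_le_pow_of_le_one hρ0 hρ.le (Nat.le_succ N)
      have := matBdd_of_cbNorm_le hK hv (pow_nonneg hρ0 N)
        ((feedbackRem_matBdd hα hρ0 hx N).mono h5) h
      linarith [mul_comm K (ρ ^ N), mul_assoc (ρ ^ N) K ‖WithLp.toLp 2 h‖,
        congrArg (· * ‖WithLp.toLp 2 h‖) (mul_comm K (ρ ^ N))]
    rw [h1, WithLp.toLp_add, WithLp.toLp_smul, WithLp.toLp_sum]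
    refine (norm_add_le _ _).trans (add_le_add (by simpa using h3) ?_)
    rw [norm_smul, norm_inv, Complex.norm_natCast]
    refine mul_le_mul_of_nonneg_left ?_ (by positivity)
    refine (norm_sum_le _ _).trans ((Finset.sum_le_sum fun N _ => h4 N).trans ?_)
    rw [← Finset.sum_mul]
    have h6 : ∑ N ∈ Finset.range T, ρ ^ N ≤ (1 - ρ)⁻¹ := by
      rw [← tsum_geometric_of_lt_one hρ0 hρ]
      exact (summable_geometric_of_lt_one hρ0 hρ).sum_le_tsum _ fun i _ => pow_nonneg hρ0 i
    calc _ ≤ (1 - ρ)⁻¹ * (K * ‖WithLp.toLp 2 h‖) :=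
          mul_le_mul_of_nonneg_right h6 (by positivity)
      _ = _ := by ring
  have hlim : Filter.Tendsto (fun T : ℕ => K * ‖WithLp.toLp 2 p‖ +
      (T : ℝ)⁻¹ * (K * (1 - ρ)⁻¹ * ‖WithLp.toLp 2 h‖)) Filter.atTop
      (nhds (K * ‖WithLp.toLp 2 p‖ + 0 * (K * (1 - ρ)⁻¹ * ‖WithLp.toLp 2 h‖))) :=
    tendsto_const_nhds.add (tendsto_inv_atTop_nhds_zero_nat.mul_const _)
  rw [zero_mul, add_zero] at hlim
  exact ge_of_tendsto hlim ((Filter.eventually_gt_atTop 0).mono key)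

/-- The form making a completely bounded homomorphism completely contractive. -/
theorem exists_core_of_cbNorm_le {v : A →ₐ[ℂ] (H →L[ℂ] H)} {K : ℝ} (hK : 0 ≤ K)
    (hv : cbNorm v ≤ ENNReal.ofReal K) :
    ∃ B : PreInnerProductSpace.Core ℂ H, (∀ m, (B.inner m m).re ≤ K ^ 2 * ‖m‖ ^ 2) ∧
      (∀ m, ‖m‖ ^ 2 ≤ (B.inner m m).re) ∧
      ∀ (ι : Type) [Fintype ι] (x : Matrix ι ι A) (ρ : ℝ) (h : ι → H), 0 ≤ ρ → ρ < 1 →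
        MatBdd A.val x ρ → ∑ i, (B.inner (act (vecAct v) x h i) (act (vecAct v) x h i)).re ≤
          ∑ i, (B.inner (h i) (h i)).re := by
  -- These are the consequences of three kinds of inequality: `B (x h) ≤ B h`, `B p ≤ K² ‖p‖²` and
  -- `‖q‖² ≤ B q`. Finite tuples and block diagonal sums make the set a cone.
  let S : Set ((Module.Dual ℂ H → ℝ) × ℝ) := {s | ∃ (ι κ l : Type) (_ : Fintype ι) (_ : Fintype κ)
    (_ : Fintype l) (x : Matrix ι ι A) (ρ : ℝ) (h : ι → H) (p : κ → H) (q : l → H),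
    0 ≤ ρ ∧ ρ < 1 ∧ MatBdd A.val x ρ ∧
    (∀ φ : Module.Dual ℂ H, ∑ i, ‖φ (h i)‖ ^ 2 + ∑ i, ‖φ (q i)‖ ^ 2 -
      (∑ i, ‖φ (act (vecAct v) x h i)‖ ^ 2 + ∑ i, ‖φ (p i)‖ ^ 2) ≤ s.1 φ) ∧
    K ^ 2 * ∑ i, ‖p i‖ ^ 2 - ∑ i, ‖q i‖ ^ 2 ≤ s.2}
  have hp : ∀ m, ((fun φ : Module.Dual ℂ H => -‖φ m‖ ^ 2), K ^ 2 * ‖m‖ ^ 2) ∈ S := fun m =>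
    ⟨Empty, Unit, Empty, inferInstance, inferInstance, inferInstance, 0, 0, Empty.elim,
      fun _ => m, Empty.elim, le_rfl, one_pos, MatBdd.zero, fun φ => by simp, by simp⟩
  refine (exists_core_of_consistent S ?_ ?_ ?_ ?_ fun m => ⟨_, hp m⟩).imp fun B hB => ?_
  · intro y t hy ht
    exact ⟨Empty, Empty, Empty, inferInstance, inferInstance, inferInstance, 0, 0, Empty.elim,
      Empty.elim, Empty.elim, le_rfl, one_pos, MatBdd.zero, fun φ => by simpa using hy φ,
      by simpa using ht⟩
  · rintro s ⟨ι, κ, l, _, _, _, x, ρ, h, p, q, hρ0, hρ, hx, hφ, ht⟩ s'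
      ⟨ι', κ', l', _, _, _, x', ρ', h', p', q', hρ0', hρ', hx', hφ', ht'⟩
    refine ⟨ι ⊕ ι', κ ⊕ κ', l ⊕ l', inferInstance, inferInstance, inferInstance,
      Matrix.fromBlocks x 0 0 x', max ρ ρ', Sum.elim h h', Sum.elim p p', Sum.elim q q',
      le_max_of_le_left hρ0, max_lt hρ hρ', MatBdd.fromBlocks_diagonal (le_max_of_le_left hρ0)
        (hx.mono (le_max_left _ _)) (hx'.mono (le_max_right _ _)), fun φ => ?_, ?_⟩
    · rw [act_fromBlocks_diagonal]
      simp only [Fintype.sum_sum_type, Sum.elim_inl, Sum.elim_inr, Prod.fst_add, Pi.add_apply]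
      linarith [hφ φ, hφ' φ]
    · simp only [Fintype.sum_sum_type, Sum.elim_inl, Sum.elim_inr, Prod.snd_add]
      linarith
  · rintro r hr s ⟨ι, κ, l, _, _, _, x, ρ, h, p, q, hρ0, hρ, hx, hφ, ht⟩
    have hn : ∀ {ι : Type} [Fintype ι] (h : ι → H),
        ∑ i, ‖(((√r : ℝ) : ℂ) • h) i‖ ^ 2 = r * ∑ i, ‖h i‖ ^ 2 := fun h => by
      rw [Finset.mul_sum]
      exact Finset.sum_congr rfl fun i _ => by
        rw [Pi.smul_apply, norm_smul, mul_pow, Complex.norm_real, Real.norm_eq_abs, sq_abs,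
          Real.sq_sqrt hr.le]
    refine ⟨ι, κ, l, inferInstance, inferInstance, inferInstance, x, ρ, ((√r : ℝ) : ℂ) • h,
      ((√r : ℝ) : ℂ) • p, ((√r : ℝ) : ℂ) • q, hρ0, hρ, hx, fun φ => ?_, ?_⟩
    · rw [map_smul]
      simp only [sum_norm_sq_dual_smul hr.le, Prod.smul_fst, Pi.smul_apply _ s.1, smul_eq_mul]
      linarith [mul_le_mul_of_nonneg_left (hφ φ) hr.le]
    · simp only [hn, Prod.smul_snd, smul_eq_mul]
      linarith [mul_le_mul_of_nonneg_left ht hr.le]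
  · rintro t ⟨ι, κ, l, _, _, _, x, ρ, h, p, q, hρ0, hρ, hx, hφ, ht⟩
    have := norm_le_of_feedback hK hv hρ0 hρ hx h p q fun φ => by
      have := hφ φ
      simp only [Pi.zero_apply] at this
      linarith
    rw [← sq_le_sq₀ (norm_nonneg _) (by positivity), mul_pow, norm_toLp_sq, norm_toLp_sq] at this
    linarith
  · refine ⟨fun m => ?_, fun m => ?_, fun ι _ x ρ h hρ0 hρ hx => ?_⟩
    · simpa using hB Unit Empty inferInstance inferInstance (fun _ => m) Empty.elim (K ^ 2 * ‖m‖ ^ 2)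
        (by simpa using hp m)
    · have := hB Empty Unit inferInstance inferInstance Empty.elim (fun _ => m) (-‖m‖ ^ 2)
        ⟨Empty, Empty, Unit, inferInstance, inferInstance, inferInstance, 0, 0, Empty.elim,
          Empty.elim, fun _ => m, le_rfl, one_pos, MatBdd.zero, fun φ => by simp, by simp⟩
      simp only [Finset.univ_eq_empty, Finset.sum_empty, Finset.univ_unique, Finset.sum_const,
        Finset.card_singleton, one_smul] at this
      linarith
    · have := hB ι ι inferInstance inferInstance (act (vecAct v) x h) h 0
        ⟨ι, Empty, Empty, inferInstance, inferInstance, inferInstance, x, ρ, h,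
          Empty.elim, Empty.elim, hρ0, hρ, hx, fun φ => by simp, by simp⟩
      simpa using this

/-- Conjugation of a homomorphism by an invertible operator. -/
def conjHom {A : Type*} [Ring A] [Algebra ℂ A] (v : A →ₐ[ℂ] (H →L[ℂ] H)) (S : (H →L[ℂ] H)ˣ) :
    A →ₐ[ℂ] (H →L[ℂ] H) :=
  AlgHom.ofLinearMap
    { toFun := fun a => (↑S⁻¹ : H →L[ℂ] H) * v a * (S : H →L[ℂ] H)
      map_add' := fun a b => by rw [map_add, mul_add, add_mul]
      map_smul' := fun c a => by simp }
    (by simp) (fun a b => by simp [mul_assoc])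

/-- Completely bounded homomorphisms are similar to completely contractive ones. -/
theorem exists_similar_of_isCompletelyBounded [CompleteSpace H] (v : A →ₐ[ℂ] (H →L[ℂ] H))
    (hv : IsCompletelyBounded v) : ∃ w, IsSimilar v w ∧ IsCompletelyContractive w := by
  have hv' : cbNorm v ≤ ENNReal.ofReal (cbNorm v).toReal := (ENNReal.ofReal_toReal hv.ne).ge
  obtain ⟨B, hB1, hB2, hB3⟩ := exists_core_of_cbNorm_le ENNReal.toReal_nonneg hv'
  obtain ⟨T, hT⟩ := exists_unit_of_core B _ hB1 hB2
  refine ⟨conjHom v T⁻¹, ⟨T⁻¹, fun a => rfl⟩, ?_⟩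
  rw [IsCompletelyContractive, ← ENNReal.ofReal_one, cbNorm_le_iff _ zero_le_one]
  intro n x hx
  rw [matBdd_iff zero_le_one]
  intro ξ
  let h : Fin n → H := fun i => (↑T⁻¹ : H →L[ℂ] H) (ξ i)
  have h1 : ∀ i, (T : H →L[ℂ] H) (h i) = ξ i := fun i => by
    rw [← mul_apply_eq_comp, Units.mul_inv, one_apply_eq_self]
  have h2 : ∀ j, ‖∑ i, conjHom v T⁻¹ (x j i) (ξ i)‖ ^ 2 =
      (B.inner (act (vecAct v) x h j) (act (vecAct v) x h j)).re := fun j => by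
    rw [← hT, act_apply, map_sum]
    rfl
  have h3 : ∀ i, ‖ξ i‖ ^ 2 = (B.inner (h i) (h i)).re := fun i => by rw [← hT, h1]
  simp only [h2, h3, one_pow, one_mul]
  -- The form is contractive only for matrices of norm strictly below one, so `x` is scaled by ρ and
  -- ρ tends to 1.
  have h4 : ∀ ρ : ℝ, 0 ≤ ρ → ρ < 1 → ρ ^ 2 *
      ∑ i, (B.inner (act (vecAct v) x h i) (act (vecAct v) x h i)).re ≤
        ∑ i, (B.inner (h i) (h i)).re := fun ρ hρ0 hρ => by
    have h5 : MatBdd A.val ((ρ : ℂ) • x) ρ := (hx.smul (ρ : ℂ)).mono (by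
      rw [Complex.norm_real, Real.norm_of_nonneg hρ0, mul_one])
    have h6 := hB3 (Fin n) _ ρ h hρ0 hρ h5
    refine le_trans (le_of_eq ?_) h6
    rw [Finset.mul_sum]
    refine Finset.sum_congr rfl fun i _ => ?_
    rw [← hT, ← hT, map_smul, LinearMap.smul_apply, Pi.smul_apply, map_smul, norm_smul, mul_pow,
      Complex.norm_real, Real.norm_of_nonneg hρ0]
  have hlim : Filter.Tendsto (fun ρ : ℝ => ρ ^ 2 *
      ∑ i, (B.inner (act (vecAct v) x h i) (act (vecAct v) x h i)).re)
      (nhdsWithin 1 (Set.Iio 1)) (nhds (1 ^ 2 *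
        ∑ i, (B.inner (act (vecAct v) x h i) (act (vecAct v) x h i)).re)) :=
    (Continuous.tendsto (by fun_prop) 1).mono_left nhdsWithin_le_nhds
  rw [one_pow, one_mul] at hlim
  refine le_of_tendsto hlim ?_
  filter_upwards [Ioo_mem_nhdsLT (zero_lt_one' ℝ)] with ρ hρ
  exact h4 ρ hρ.1.le hρ.2

/-- A homomorphism similar to a completely contractive one is completely bounded. -/
theorem isCompletelyBounded_of_similar {v w : A →ₐ[ℂ] (H →L[ℂ] H)} (hvw : IsSimilar v w)
    (hw : IsCompletelyContractive w) : IsCompletelyBounded v := by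
  classical
  obtain ⟨S, hS⟩ := hvw
  rw [IsCompletelyContractive, ← ENNReal.ofReal_one, cbNorm_le_iff _ zero_le_one] at hw
  have hvw : ∀ a, v a = (S : H →L[ℂ] H) * w a * (↑S⁻¹ : H →L[ℂ] H) := fun a => by
    rw [hS]; simp [mul_assoc]
  have hR : ∀ (R : H →L[ℂ] H) (n : ℕ) (ξ : Fin n → H),
      ‖WithLp.toLp 2 fun i => R (ξ i)‖ ≤ ‖R‖ * ‖WithLp.toLp 2 ξ‖ := fun R n ξ => by
    rw [← sq_le_sq₀ (norm_nonneg _) (by positivity), mul_pow, norm_toLp_sq, norm_toLp_sq,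
      Finset.mul_sum]
    refine Finset.sum_le_sum fun i _ => ?_
    rw [← mul_pow]
    exact pow_le_pow_left₀ (norm_nonneg _) (R.le_opNorm _) 2
  refine lt_of_le_of_lt ((cbNorm_le_iff v (K := ‖(S : H →L[ℂ] H)‖ * ‖(↑S⁻¹ : H →L[ℂ] H)‖)
    (by positivity)).2 fun n x hx ξ => ?_) ENNReal.ofReal_lt_top
  have h1 : act (vecAct v) x ξ = fun j => (S : H →L[ℂ] H)
      (act (vecAct w) x (fun i => (↑S⁻¹ : H →L[ℂ] H) (ξ i)) j) := by
    ext j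
    simp [act_apply, hvw]
  rw [h1, mul_assoc]
  refine (hR _ _ _).trans (mul_le_mul_of_nonneg_left ?_ (norm_nonneg _))
  refine (hw n x hx _).trans ?_
  rw [one_mul]
  exact hR _ _ _

end Similarity

/-! ### Uniform bounds by direct sums, and matrices of given degree -/

section Degree

section DirectSum

variable {E : ℕ → Type u} [∀ n, NormedAddCommGroup (E n)] [∀ n, InnerProductSpace ℂ (E n)]

theorem norm_apply_le_norm_smul (T : ∀ n, E n →L[ℂ] E n) {C : ℝ} (hT : ∀ n, ‖T n‖ ≤ C)
    (x : lp E 2) (n : ℕ) : ‖T n (x n)‖ ≤ ‖(((C : ℂ) • x : lp E 2) : ∀ n, E n) n‖ := by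
  rw [lp.coeFn_smul, Pi.smul_apply, norm_smul, Complex.norm_real,
    Real.norm_of_nonneg ((norm_nonneg _).trans (hT n))]
  exact (T n).le_of_opNorm_le (hT n) _

/-- The direct sum of a uniformly bounded sequence of operators, as a linear map. -/
def lpDiagonalLinear (T : ∀ n, E n →L[ℂ] E n) (C : ℝ) (hT : ∀ n, ‖T n‖ ≤ C) :
    lp E 2 →ₗ[ℂ] lp E 2 where
  toFun x := ⟨fun n => T n (x n),
    (lp.memℓp ((C : ℂ) • x)).mono' (norm_apply_le_norm_smul T hT x)⟩
  map_add' x y := by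
    ext n
    change T n (x n + y n) = _
    rw [map_add]
    rfl
  map_smul' c x := by ext n; simp

theorem norm_lpDiagonalLinear_le (T : ∀ n, E n →L[ℂ] E n) (C : ℝ) (hT : ∀ n, ‖T n‖ ≤ C)
    (x : lp E 2) : ‖lpDiagonalLinear T C hT x‖ ≤ C * ‖x‖ := by
  refine (lp.norm_mono (by simp) (y := (C : ℂ) • x) (norm_apply_le_norm_smul T hT x)).trans ?_
  rw [norm_smul, Complex.norm_real, Real.norm_of_nonneg ((norm_nonneg _).trans (hT 0))]

/-- The direct sum of a uniformly bounded sequence of operators. -/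
def lpDiagonal (T : ∀ n, E n →L[ℂ] E n) (C : ℝ) (hT : ∀ n, ‖T n‖ ≤ C) : lp E 2 →L[ℂ] lp E 2 :=
  (lpDiagonalLinear T C hT).mkContinuous C (norm_lpDiagonalLinear_le T C hT)

theorem lpDiagonal_apply (T : ∀ n, E n →L[ℂ] E n) (C : ℝ) (hT : ∀ n, ‖T n‖ ≤ C) (x : lp E 2)
    (n : ℕ) : lpDiagonal T C hT x n = T n (x n) := rfl

theorem norm_lpDiagonal_le (T : ∀ n, E n →L[ℂ] E n) (C : ℝ) (hT : ∀ n, ‖T n‖ ≤ C) :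
    ‖lpDiagonal T C hT‖ ≤ C :=
  LinearMap.mkContinuous_norm_le _ ((norm_nonneg _).trans (hT 0)) _

variable {A : Type*} [Ring A] [Algebra ℂ A]

/-- The direct sum of a pointwise bounded sequence of homomorphisms. -/
def lpDiagonalHom (v : ∀ n, A →ₐ[ℂ] (E n →L[ℂ] E n)) (C : A → ℝ) (hC : ∀ n a, ‖v n a‖ ≤ C a) :
    A →ₐ[ℂ] (lp E 2 →L[ℂ] lp E 2) :=
  AlgHom.ofLinearMap
    { toFun := fun a => lpDiagonal (fun n => v n a) (C a) fun n => hC n a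
      map_add' := fun a b => by ext x n; simp [lpDiagonal_apply]
      map_smul' := fun c a => by ext x n; simp [lpDiagonal_apply] }
    (by ext x n; simp [lpDiagonal_apply]) (fun a b => by ext x n; simp [lpDiagonal_apply])

/-- Test on tuples supported in the `n`-th summand, where the direct sum acts as `v n`. -/
theorem matBdd_of_lpDiagonalHom {v : ∀ n, A →ₐ[ℂ] (E n →L[ℂ] E n)} {C : A → ℝ}
    {hC : ∀ n a, ‖v n a‖ ≤ C a} {ι κ : Type*} [Fintype ι] [Fintype κ] {X : Matrix κ ι A} {r : ℝ}
    (hr : 0 ≤ r) (hX : MatBdd (lpDiagonalHom v C hC) X r) (n : ℕ) : MatBdd (v n) X r := by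
  rw [matBdd_iff hr] at hX ⊢
  intro ξ
  refine le_trans (Finset.sum_le_sum fun j _ => ?_) ((hX fun i => lp.single 2 n (ξ i)).trans ?_)
  · refine pow_le_pow_left₀ (norm_nonneg _) ?_ 2
    refine le_trans (le_of_eq ?_) (lp.norm_apply_le_norm two_ne_zero _ n)
    congr 1
    rw [lp.coeFn_sum, Finset.sum_apply]
    refine Finset.sum_congr rfl fun i _ => ?_
    change _ = v n (X j i) (lp.single 2 n (ξ i) n)
    rw [lp.single_apply_self]
  · refine mul_le_mul_of_nonneg_left (Finset.sum_le_sum fun i _ => ?_) (by positivity)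
    rw [lp.norm_single (by norm_num)]

end DirectSum

variable {H₀ : Type u} [NormedAddCommGroup H₀] [InnerProductSpace ℂ H₀]
  {A : Subalgebra ℂ (H₀ →L[ℂ] H₀)}

/-- If bounded homomorphisms are completely bounded, then they are uniformly so. -/
theorem exists_uniform_cbNorm_bound
    (hb : ∀ (H : Type u) [NormedAddCommGroup H] [InnerProductSpace ℂ H] [CompleteSpace H]
      (v : A →ₐ[ℂ] (H →L[ℂ] H)), IsBdd v → IsCompletelyBounded v) (c : ℝ) (hc : 0 ≤ c) :
    ∃ Φ : ℝ, 0 ≤ Φ ∧ ∀ (H : Type u) [NormedAddCommGroup H] [InnerProductSpace ℂ H]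
      [CompleteSpace H] (v : A →ₐ[ℂ] (H →L[ℂ] H)),
      (∀ a : A, ‖v a‖ ≤ c * ‖(a : H₀ →L[ℂ] H₀)‖) → cbNorm v ≤ ENNReal.ofReal Φ := by
  by_contra! hcon
  -- Were there no common bound, the direct sum of homomorphisms with cb norm above every `n` would
  -- be bounded but not completely bounded.
  choose E i1 i2 i3 v hv hv' using fun n : ℕ => hcon n n.cast_nonneg
  let w := lpDiagonalHom v (fun a => c * ‖(a : H₀ →L[ℂ] H₀)‖) hv
  have hw : IsBdd w := lt_of_le_of_lt ((opNorm_le_iff w hc).2 fun a =>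
    norm_lpDiagonal_le _ _ fun n => hv n a) ENNReal.ofReal_lt_top
  have hw2 := hb _ w hw
  obtain ⟨n, hn⟩ := exists_nat_ge (cbNorm w).toReal
  have hw3 : cbNorm w ≤ ENNReal.ofReal n :=
    (ENNReal.ofReal_toReal hw2.ne).ge.trans (ENNReal.ofReal_le_ofReal hn)
  refine (hv' n).not_ge ?_
  rw [cbNorm_le_iff _ n.cast_nonneg] at hw3 ⊢
  exact fun m x hx => matBdd_of_lpDiagonalHom n.cast_nonneg (hw3 m x hx) n

variable (A) in
/-- Matrices on which homomorphisms of norm at most `C` are bounded by `C ^ k`. -/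
def HasDegree {ι κ : Type*} [Fintype ι] [Fintype κ] (k : ℕ) (z : Matrix κ ι A) : Prop :=
  ∀ (H : Type u) [NormedAddCommGroup H] [InnerProductSpace ℂ H] [CompleteSpace H]
    (v : A →ₐ[ℂ] (H →L[ℂ] H)) (C : ℝ), 0 ≤ C → (∀ a : A, ‖v a‖ ≤ C * ‖(a : H₀ →L[ℂ] H₀)‖) →
    MatBdd v z (C ^ k)

section HasDegree

variable {ι κ l : Type*} [Fintype ι] [Fintype κ] [Fintype l]

theorem HasDegree.zero (k : ℕ) : HasDegree A k (0 : Matrix κ ι A) :=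
  fun _ _ _ _ _ _ hC _ => MatBdd.zero.mono (pow_nonneg hC k)

theorem HasDegree.smul {k : ℕ} {z : Matrix κ ι A} (hz : HasDegree A k z) {c : ℂ} (hc : ‖c‖ ≤ 1) :
    HasDegree A k (c • z) := fun H _ _ _ v C hC hv =>
  ((hz H v C hC hv).smul c).mono (mul_le_of_le_one_left (pow_nonneg hC k) hc)

theorem HasDegree.combo {k : ℕ} {z z' : Matrix κ ι A} (hz : HasDegree A k z)
    (hz' : HasDegree A k z') {a b : ℝ} (ha : 0 ≤ a) (hb : 0 ≤ b) (hab : a + b = 1) :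
    HasDegree A k (a • z + b • z') := fun H _ _ _ v C hC hv => by
  have h1 := ((hz H v C hC hv).smul (a : ℂ)).add ((hz' H v C hC hv).smul (b : ℂ))
  rw [Complex.norm_real, Complex.norm_real, Real.norm_of_nonneg ha, Real.norm_of_nonneg hb,
    ← add_mul, hab, one_mul] at h1
  exact h1

theorem IsContractive.hasDegree_mul {γ : Matrix l κ ℂ} (hγ : IsContractive γ) {k : ℕ}
    {z : Matrix κ ι A} (hz : HasDegree A k z) : HasDegree A k (scal A γ * z) :=
  fun H _ _ _ v C hC hv =>
    ((hγ.matBdd v).mul zero_le_one (hz H v C hC hv)).mono (one_mul _).le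

theorem IsContractive.hasDegree {γ : Matrix κ ι ℂ} (hγ : IsContractive γ) :
    HasDegree A 0 (scal A γ) :=
  fun _ _ _ _ v _ _ _ => (hγ.matBdd v).mono (pow_zero _).ge

theorem matBdd_diagonal [DecidableEq ι] {E : Type*} [NormedAddCommGroup E] [InnerProductSpace ℂ E]
    {B : Type*} [Ring B] [Algebra ℂ B] {v : B →ₐ[ℂ] (E →L[ℂ] E)} {g : ι → B} {C : ℝ} (hC : 0 ≤ C)
    (hg : ∀ i, ‖v (g i)‖ ≤ C) : MatBdd v (Matrix.diagonal g) C := by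
  rw [matBdd_iff hC]
  intro ξ
  rw [Finset.mul_sum]
  refine Finset.sum_le_sum fun j _ => ?_
  rw [Finset.sum_eq_single j, Matrix.diagonal_apply_eq, ← mul_pow]
  · exact pow_le_pow_left₀ (norm_nonneg _) ((v (g j)).le_of_opNorm_le (hg j) _) 2
  · intro i _ hij
    simp [Matrix.diagonal_apply_ne _ hij.symm]
  · simp

/-- The term contains `k + 1` diagonal factors, each costing at most `C`; the scalar contractions
between them cost nothing. -/
theorem hasDegree_feedbackTerm [DecidableEq ι] {α : Matrix (ι ⊕ l) (ι ⊕ κ) ℂ}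
    (hα : IsContractive α) {g : ι → A} (hg : ∀ i, ‖(g i : H₀ →L[ℂ] H₀)‖ ≤ 1) (k : ℕ) :
    HasDegree A (k + 1) (feedbackTerm α (Matrix.diagonal g) k) := fun _ _ _ _ _ _ hC hv =>
  feedbackTerm_matBdd hα hC (matBdd_diagonal hC fun i =>
    (hv (g i)).trans (mul_le_of_le_one_right hC (hg i))) k

theorem feedbackTerm_smul {B : Type*} [Ring B] [Algebra ℂ B] [DecidableEq ι]
    (α : Matrix (ι ⊕ l) (ι ⊕ κ) ℂ) (x : Matrix ι ι B) (c : ℂ) (k : ℕ) :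
    feedbackTerm α (c • x) k = c ^ (k + 1) • feedbackTerm α x k := by
  simp only [feedbackTerm, Matrix.mul_smul, smul_pow, Matrix.smul_mul, smul_smul]
  rw [pow_succ]

variable (A) in
/-- Finite sums `∑ 2⁻ᵏ z_k` with `z_k` of degree `k`. -/
def degreeSums (n : ℕ) : Set (Fin n → Fin n → A) :=
  {y | ∃ (N : ℕ) (z : ℕ → Matrix (Fin n) (Fin n) A), (∀ k, HasDegree A k (z k)) ∧
    Matrix.of y = ∑ k ∈ Finset.range N, ((2 : ℂ)⁻¹) ^ k • z k}

theorem zero_mem_degreeSums (n : ℕ) : (0 : Fin n → Fin n → A) ∈ degreeSums A n :=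
  ⟨0, fun _ => 0, fun k => HasDegree.zero k, by simp⟩

theorem smul_mem_degreeSums {n : ℕ} {y : Fin n → Fin n → A} (hy : y ∈ degreeSums A n) {c : ℂ}
    (hc : ‖c‖ ≤ 1) : c • y ∈ degreeSums A n := by
  obtain ⟨N, z, hz, hy⟩ := hy
  refine ⟨N, fun k => c • z k, fun k => (hz k).smul hc, ?_⟩
  change c • Matrix.of y = _
  rw [hy, Finset.smul_sum]
  exact Finset.sum_congr rfl fun k _ => smul_comm _ _ _

-- Each degree class is closed under convex combinations; sums of different lengths are first padded
-- with zeros.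
set_option synthInstance.maxHeartbeats 200000 in
theorem convex_degreeSums (n : ℕ) : Convex ℝ (degreeSums A n) := by
  rintro y ⟨N, z, hz, hy⟩ y' ⟨N', z', hz', hy'⟩ a b ha hb hab
  have ext : ∀ (N M : ℕ) (z : ℕ → Matrix (Fin n) (Fin n) A), N ≤ M →
      ∑ k ∈ Finset.range N, ((2 : ℂ)⁻¹) ^ k • z k =
        ∑ k ∈ Finset.range M, ((2 : ℂ)⁻¹) ^ k • (if k < N then z k else 0) := fun N M z hNM => by
    rw [← Finset.sum_subset (Finset.range_mono hNM)]
    · exact Finset.sum_congr rfl fun k hk => by rw [if_pos (Finset.mem_range.1 hk)]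
    · intro k _ hk
      rw [if_neg (fun h => hk (Finset.mem_range.2 h)), smul_zero]
  have hite : ∀ (N : ℕ) (z : ℕ → Matrix (Fin n) (Fin n) A), (∀ k, HasDegree A k (z k)) →
      ∀ k, HasDegree A k (if k < N then z k else 0) := fun N z hz k => by
    split_ifs
    · exact hz k
    · exact HasDegree.zero k
  refine ⟨max N N', fun k => a • (if k < N then z k else 0) + b • (if k < N' then z' k else 0),
    fun k => (hite N z hz k).combo (hite N' z' hz' k) ha hb hab, ?_⟩
  change a • Matrix.of y + b • Matrix.of y' = _
  rw [hy, hy', ext N _ z (le_max_left N N'),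
    ext N' _ z' (le_max_right N N'), Finset.smul_sum, Finset.smul_sum, ← Finset.sum_add_distrib]
  exact Finset.sum_congr rfl fun k _ => by rw [smul_add, smul_comm a, smul_comm b]

/-- The factor `½` in each diagonal entry supplies the weight `2⁻ᵏ`, and the constant block `α₂₂` is
the term of degree zero. -/
theorem mul_feedbackSum_mem_degreeSums {n : ℕ} [DecidableEq ι]
    {α : Matrix (ι ⊕ l) (ι ⊕ Fin n) ℂ} (hα : IsContractive α) {γ : Matrix (Fin n) l ℂ}
    (hγ : IsContractive γ) {g : ι → A} (hg : ∀ i, ‖(g i : H₀ →L[ℂ] H₀)‖ ≤ 1) (N : ℕ) :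
    (fun i j => (scal A γ * feedbackSum α ((2 : ℂ)⁻¹ • Matrix.diagonal g) N) i j) ∈
      degreeSums A n := by
  refine ⟨N + 1, fun k => k.casesOn (scal A γ * scal A α.toBlocks₂₂)
    fun k => scal A γ * feedbackTerm α (Matrix.diagonal g) k, fun k => ?_, ?_⟩
  · cases k with
    | zero => exact hγ.hasDegree_mul hα.toBlocks.2.2.2.hasDegree
    | succ k => exact hγ.hasDegree_mul (hasDegree_feedbackTerm hα hg k)
  · change scal A γ * feedbackSum α ((2 : ℂ)⁻¹ • Matrix.diagonal g) N = _
    rw [Finset.sum_range_succ', feedbackSum, Matrix.mul_add, Matrix.mul_sum, add_comm]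
    simp only [feedbackTerm_smul, Matrix.mul_smul, pow_zero, one_smul]
    rfl

end HasDegree

end Degree

/-! ### Functionals on matrices and the homomorphisms dominating them -/

section Functional

variable {A : Type u} [NormedRing A] [NormedAlgebra ℂ A]

variable (A) in
/-- The action of `A` by left multiplication on `Aⁿ`. -/
def leftAct (n : ℕ) : A →ₐ[ℂ] Module.End ℂ (Fin n → A) := Algebra.lsmul ℂ ℂ (Fin n → A)

theorem leftAct_apply {n : ℕ} (a : A) (m : Fin n → A) (j : Fin n) :
    leftAct A n a m j = a * m j := rfl

/-- Applied to the unit vectors of `Aⁿ`, a matrix returns its own rows. Thus a functional on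
matrices is read as one on `n`-tuples of vectors of `Aⁿ`. -/
theorem act_leftAct_single {n : ℕ} {κ : Type*} [Fintype κ] (Z : Matrix κ (Fin n) A) (c : ℂ) :
    act (leftAct A n) Z (fun j => c • Pi.single j 1) = c • fun i j => Z i j := by
  ext1 i
  ext1 j
  rw [act_apply, Finset.sum_apply, Finset.sum_eq_single j]
  · rw [leftAct_apply, Pi.smul_apply, Pi.single_eq_same, mul_smul_comm, mul_one]
    rfl
  · intro k _ hk
    rw [leftAct_apply, Pi.smul_apply, Pi.single_eq_of_ne hk.symm, smul_zero, mul_zero]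
  · simp

/-- A functional bounded by one on the transfer functions at halved diagonal contractions. -/
def FeedbackBounded {n : ℕ} (f : StrongDual ℂ (Fin n → Fin n → A)) : Prop :=
  ∀ (ι l : Type) [Fintype ι] [Fintype l] [DecidableEq ι] (α : Matrix (ι ⊕ l) (ι ⊕ Fin n) ℂ)
    (γ : Matrix (Fin n) l ℂ) (g : ι → A), IsContractive α → IsContractive γ → (∀ i, ‖g i‖ ≤ 1) →
    ∀ N, ‖f fun i j => (scal A γ * feedbackSum α ((2 : ℂ)⁻¹ • Matrix.diagonal g) N) i j‖ ≤ 1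

variable (A) in
/-- Geometric decay of the remainders of the transfer functions at halved diagonal contractions. -/
def RemainderDecay (n : ℕ) : Prop :=
  ∀ (ι l : Type) [Fintype ι] [Fintype l] [DecidableEq ι] (α : Matrix (ι ⊕ l) (ι ⊕ Fin n) ℂ)
    (γ : Matrix (Fin n) l ℂ) (g : ι → A), IsContractive α → IsContractive γ → (∀ i, ‖g i‖ ≤ 1) →
    ∀ N i k, ‖(scal A γ * feedbackRem α ((2 : ℂ)⁻¹ • Matrix.diagonal g) N) i k‖ ≤ (2⁻¹ : ℝ) ^ N

/-- The `1 × L` row `β`, amplified by the identity of size `n`. -/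
def rowMatrix {L : Type*} (n : ℕ) (β : L → ℂ) : Matrix (Fin n) (L × Fin n) ℂ :=
  fun i s => if i = s.2 then β s.1 else 0

theorem rowMatrix_smul_sum {L : Type*} [Fintype L] {n : ℕ} (β : L → ℂ) {M : Type*}
    [AddCommGroup M] [Module ℂ M] (z : L × Fin n → M) (i : Fin n) :
    ∑ s, rowMatrix n β i s • z s = ∑ l, β l • z (l, i) := by
  rw [Fintype.sum_prod_type]
  simp [rowMatrix, ite_smul]

theorem isContractive_rowMatrix {L : Type*} [Fintype L] (n : ℕ) {β : L → ℂ}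
    (hβ : ∑ l, ‖β l‖ ^ 2 ≤ 1) : IsContractive (rowMatrix n β) := fun z => by
  rw [Fintype.sum_prod_type_right]
  refine Finset.sum_le_sum fun i _ => ?_
  have h1 := rowMatrix_smul_sum β z i
  simp only [smul_eq_mul] at h1
  rw [h1]
  calc ‖∑ l, β l * z (l, i)‖ ^ 2 ≤ (∑ l, ‖β l‖ * ‖z (l, i)‖) ^ 2 := by
        refine pow_le_pow_left₀ (norm_nonneg _) ((norm_sum_le _ _).trans ?_) 2
        simp
    _ ≤ (∑ l, ‖β l‖ ^ 2) * ∑ l, ‖z (l, i)‖ ^ 2 := Finset.sum_mul_sq_le_sq_mul_sq _ _ _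
    _ ≤ _ := mul_le_of_le_one_left (by positivity) hβ

/-- Feedback estimate for functionals bounded on transfer functions. -/
theorem sum_sq_le_of_feedback {n : ℕ} (f : StrongDual ℂ (Fin n → Fin n → A))
    (hdec : RemainderDecay A n) (hf : FeedbackBounded f) {ι L : Type} [Fintype ι] [Fintype L]
    {g : ι → A} (hg : ∀ i, ‖g i‖ ≤ 1) (h : ι → Fin n → A) {s : ℝ} (hs : 0 ≤ s)
    (q : L × Fin n → Fin n → A)
    (hle : ∀ φ : Module.Dual ℂ (Fin n → A), ∑ i, ‖φ (h i)‖ ^ 2 + ∑ i, ‖φ (q i)‖ ^ 2 ≤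
      ∑ i, ‖φ ((2 : ℂ)⁻¹ • leftAct A n (g i) (h i))‖ ^ 2 +
        s * ∑ j, ‖φ (Pi.single j 1)‖ ^ 2) :
    ∑ l, ‖f fun i => q (l, i)‖ ^ 2 ≤ s := by
  classical
  let x : Matrix ι ι A := (2 : ℂ)⁻¹ • Matrix.diagonal g
  let p : Fin n → Fin n → A := fun j => ((√s : ℝ) : ℂ) • Pi.single j 1
  have hxh : act (leftAct A n) x h = fun i => (2 : ℂ)⁻¹ • leftAct A n (g i) (h i) := by
    ext1 i
    rw [map_smul, LinearMap.smul_apply, Pi.smul_apply, act_apply, Finset.sum_eq_single i,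
      Matrix.diagonal_apply_eq]
    · intro k _ hk
      rw [Matrix.diagonal_apply_ne _ hk.symm, map_zero, LinearMap.zero_apply]
    · simp
  obtain ⟨α, hα, hα'⟩ := exists_contractive_matrix_of_dual_sum_le
    (Sum.elim (act (leftAct A n) x h) p) (Sum.elim h q) (fun φ => by
      have h1 := sum_norm_sq_dual_smul hs (fun j : Fin n => (Pi.single j 1 : Fin n → A)) φ
      simp only [Fintype.sum_sum_type, Sum.elim_inl, Sum.elim_inr, hxh]
      exact (hle φ).trans (add_le_add_right h1.ge _))
  replace hα : IsContractive α := hα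
  have hfb := eq_feedback (leftAct A n) α x h p q hα'
  -- By `ℓ²` duality it suffices to test against unit rows β. Such a row is absorbed into the
  -- transfer function as the left factor γ, on which `f` is bounded by one.
  have key : ∀ β : L → ℂ, ∑ l, ‖β l‖ ^ 2 ≤ 1 → ‖∑ l, β l * f fun i => q (l, i)‖ ≤ √s := by
    intro β hβ
    have hγ := isContractive_rowMatrix n hβ
    let W := act (leftAct A n) (scal A (rowMatrix n β)) q
    have hW : W = ∑ l, β l • fun i => q (l, i) := by
      ext1 i
      rw [Finset.sum_apply]
      simp only [W, act_scal, rowMatrix_smul_sum]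
      rfl
    have hfW : f W = ∑ l, β l * f fun i => q (l, i) := by
      rw [hW, map_sum]
      exact Finset.sum_congr rfl fun l _ => by rw [map_smul, smul_eq_mul]
    let r (N : ℕ) : Fin n → Fin n → A :=
      act (leftAct A n) (scal A (rowMatrix n β) * feedbackRem α x N) h
    have hWN : ∀ N, W = ((√s : ℝ) : ℂ) •
        (fun i j => (scal A (rowMatrix n β) * feedbackSum α x N) i j) + r N := fun N => by
      simp only [W, r]
      conv_lhs => rw [hfb N]
      rw [map_add, ← act_mul, ← act_mul, act_leftAct_single]
    have hr : Filter.Tendsto r Filter.atTop (nhds 0) := by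
      rw [tendsto_pi_nhds]
      intro i
      rw [tendsto_pi_nhds]
      intro j
      have hz : Filter.Tendsto (fun N : ℕ => (2⁻¹ : ℝ) ^ N * ∑ k, ‖h k j‖) Filter.atTop
          (nhds (0 * ∑ k, ‖h k j‖)) :=
        (tendsto_pow_atTop_nhds_zero_of_lt_one (by norm_num) (by norm_num)).mul_const _
      rw [zero_mul] at hz
      refine squeeze_zero_norm (fun N => ?_) hz
      simp only [r, act_apply, Finset.sum_apply, leftAct_apply]
      refine (norm_sum_le _ _).trans ?_
      rw [Finset.mul_sum]
      refine Finset.sum_le_sum fun k _ => (norm_mul_le _ _).trans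
        (mul_le_mul_of_nonneg_right ?_ (norm_nonneg _))
      exact hdec ι (L × Fin n) α _ g hα hγ hg N i k
    have hbound : ∀ N, ‖f W‖ ≤ √s + ‖f (r N)‖ := fun N => by
      rw [hWN N, map_add, map_smul]
      refine (norm_add_le _ _).trans (add_le_add_left ?_ _)
      rw [norm_smul, Complex.norm_real, Real.norm_of_nonneg (Real.sqrt_nonneg _)]
      exact mul_le_of_le_one_right (Real.sqrt_nonneg _)
        (hf ι (L × Fin n) α _ g hα hγ hg N)
    have hlim : Filter.Tendsto (fun N => √s + ‖f (r N)‖) Filter.atTop (nhds (√s + ‖f 0‖)) :=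
      tendsto_const_nhds.add ((f.continuous.tendsto 0).comp hr).norm
    rw [map_zero, norm_zero, add_zero] at hlim
    rw [← hfW]
    exact ge_of_tendsto' hlim hbound
  let c (l : L) : ℂ := f fun i => q (l, i)
  let σ := ∑ l, ‖c l‖ ^ 2
  have hσ : 0 ≤ σ := by positivity
  rcases hσ.eq_or_lt with h0 | h0
  · exact h0.ge.trans hs
  have hσ' : 0 < √σ := Real.sqrt_pos.2 h0
  -- This is the row attaining equality in Cauchy–Schwarz.
  have h1 := key (fun l => (((√σ)⁻¹ : ℝ) : ℂ) * starRingEnd ℂ (c l)) (by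
    simp only [norm_mul, Complex.norm_real, mul_pow, RCLike.norm_conj, ← Finset.mul_sum]
    rw [Real.norm_of_nonneg (by positivity), inv_pow, Real.sq_sqrt hσ]
    exact (inv_mul_cancel₀ h0.ne').le)
  have h2 : ∑ l, (((√σ)⁻¹ : ℝ) : ℂ) * starRingEnd ℂ (c l) * c l = ((√σ : ℝ) : ℂ) := by
    simp only [mul_assoc, ← Finset.mul_sum, ← Complex.normSq_eq_conj_mul_self,
      Complex.normSq_eq_norm_sq]
    rw [← Complex.ofReal_sum, ← Complex.ofReal_mul]
    congr 1
    change (√σ)⁻¹ * σ = √σ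
    rw [inv_mul_eq_iff_eq_mul₀ hσ'.ne', Real.mul_self_sqrt hσ]
  rw [h2, Complex.norm_real, Real.norm_of_nonneg hσ'.le] at h1
  exact (Real.sqrt_le_sqrt_iff hs).1 h1

/-- The form on `Aⁿ` attached to a functional bounded on transfer functions. -/
theorem exists_core_of_functional {n : ℕ} (f : StrongDual ℂ (Fin n → Fin n → A))
    (hdec : RemainderDecay A n) (hf : FeedbackBounded f) :
    ∃ B : PreInnerProductSpace.Core ℂ (Fin n → A),
      (∀ (g : A) (m : Fin n → A), ‖g‖ ≤ 1 →
        (B.inner ((2 : ℂ)⁻¹ • leftAct A n g m) ((2 : ℂ)⁻¹ • leftAct A n g m)).re ≤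
          (B.inner m m).re) ∧
      ∑ j, (B.inner (Pi.single j 1) (Pi.single j 1)).re ≤ 1 ∧
      ∀ q : Fin n → Fin n → A, ‖f q‖ ^ 2 ≤ ∑ i, (B.inner (q i) (q i)).re := by
  classical
  -- Here the generating inequalities are `B (½ g h) ≤ B h` for contractions `g`, `∑ B (e_j) ≤ 1`
  -- and `‖f q‖² ≤ ∑ B (q i)`; `s` is the multiplier of the second.
  let S : Set ((Module.Dual ℂ (Fin n → A) → ℝ) × ℝ) := {w | ∃ (ι L : Type) (_ : Fintype ι)
    (_ : Fintype L) (g : ι → A) (h : ι → Fin n → A) (s : ℝ) (q : L × Fin n → Fin n → A),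
    (∀ i, ‖g i‖ ≤ 1) ∧ 0 ≤ s ∧
    (∀ φ : Module.Dual ℂ (Fin n → A), ∑ i, ‖φ (h i)‖ ^ 2 + ∑ i, ‖φ (q i)‖ ^ 2 -
      (∑ i, ‖φ ((2 : ℂ)⁻¹ • leftAct A n (g i) (h i))‖ ^ 2 +
        s * ∑ j, ‖φ (Pi.single j 1)‖ ^ 2) ≤ w.1 φ) ∧
    s - ∑ l, ‖f fun i => q (l, i)‖ ^ 2 ≤ w.2}
  refine (exists_core_of_consistent S ?_ ?_ ?_ ?_ ?_).imp fun B hB => ⟨?_, ?_, ?_⟩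
  · intro y t hy ht
    exact ⟨Empty, Empty, inferInstance, inferInstance, Empty.elim, Empty.elim, 0,
      fun s => s.1.elim, fun i => i.elim, le_rfl, fun φ => by simpa using hy φ, by simpa using ht⟩
  · rintro w ⟨ι, L, _, _, g, h, s, q, hg, hs, hφ, ht⟩ w' ⟨ι', L', _, _, g', h', s', q', hg', hs',
      hφ', ht'⟩
    refine ⟨ι ⊕ ι', L ⊕ L', inferInstance, inferInstance, Sum.elim g g', Sum.elim h h', s + s',
      fun a => Sum.elim (fun l => q (l, a.2)) (fun l => q' (l, a.2)) a.1, ?_, add_nonneg hs hs',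
      fun φ => ?_, ?_⟩
    · rintro (i | i)
      · exact hg i
      · exact hg' i
    · have h1 := hφ φ
      have h2 := hφ' φ
      rw [Fintype.sum_prod_type (fun i : L × Fin n => ‖φ (q i)‖ ^ 2)] at h1
      rw [Fintype.sum_prod_type (fun i : L' × Fin n => ‖φ (q' i)‖ ^ 2)] at h2
      simp only [Fintype.sum_prod_type, Fintype.sum_sum_type, Sum.elim_inl, Sum.elim_inr,
        Prod.fst_add, Pi.add_apply, add_mul]
      linarith
    · simp only [Fintype.sum_sum_type, Sum.elim_inl, Sum.elim_inr, Prod.snd_add]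
      linarith
  · rintro r hr w ⟨ι, L, _, _, g, h, s, q, hg, hs, hφ, ht⟩
    refine ⟨ι, L, inferInstance, inferInstance, g, ((√r : ℝ) : ℂ) • h, r * s,
      ((√r : ℝ) : ℂ) • q, hg, by positivity, fun φ => ?_, ?_⟩
    · have h1 : (fun i => (2 : ℂ)⁻¹ • leftAct A n (g i) ((((√r : ℝ) : ℂ) • h) i)) =
          ((√r : ℝ) : ℂ) • fun i => (2 : ℂ)⁻¹ • leftAct A n (g i) (h i) := by
        ext1 i
        rw [Pi.smul_apply, map_smul, smul_comm]
        rfl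
      have h2 := sum_norm_sq_dual_smul hr.le (fun i => (2 : ℂ)⁻¹ • leftAct A n (g i) (h i)) φ
      rw [← h1] at h2
      rw [sum_norm_sq_dual_smul hr.le h, sum_norm_sq_dual_smul hr.le q, h2]
      change _ ≤ r * w.1 φ
      linarith [mul_le_mul_of_nonneg_left (hφ φ) hr.le]
    · have h1 : ∀ l, ‖f fun i => (((√r : ℝ) : ℂ) • q) (l, i)‖ ^ 2 =
          r * ‖f fun i => q (l, i)‖ ^ 2 := fun l => by
        have : (fun i => (((√r : ℝ) : ℂ) • q) (l, i)) = ((√r : ℝ) : ℂ) • fun i => q (l, i) := rfl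
        rw [this, map_smul, norm_smul, mul_pow, Complex.norm_real, Real.norm_eq_abs, sq_abs,
          Real.sq_sqrt hr.le]
      simp only [h1, ← Finset.mul_sum]
      change _ ≤ r * w.2
      linarith [mul_le_mul_of_nonneg_left ht hr.le]
  · rintro t ⟨ι, L, _, _, g, h, s, q, hg, hs, hφ, ht⟩
    have := sum_sq_le_of_feedback f hdec hf hg h hs q fun φ => by
      have := hφ φ
      simp only [Pi.zero_apply] at this
      linarith
    linarith
  · intro m
    let R : ℝ := ‖m‖ + 1
    have hR : 0 < R := by positivity
    -- Chosen so that `½ (m j / R)` sends `c e_j` to `√n (m j) e_j`; the factor `√n` pays for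
    -- Cauchy–Schwarz in `m = ∑ (m j) e_j`.
    let c : ℂ := ((2 * √n * R : ℝ) : ℂ)
    refine ⟨‖c‖ ^ 2, Fin n, Empty, inferInstance, inferInstance, fun j => ((R⁻¹ : ℝ) : ℂ) • m j,
      fun j => c • Pi.single j 1, ‖c‖ ^ 2, fun s => s.1.elim, fun j => ?_, by positivity,
      fun φ => ?_, by simp⟩
    · rw [norm_smul, Complex.norm_real, Real.norm_of_nonneg (by positivity),
        inv_mul_le_iff₀ hR, mul_one]
      exact (norm_le_pi_norm m j).trans (by simp [R])
    · have h1 : ∀ j, (2 : ℂ)⁻¹ • leftAct A n (((R⁻¹ : ℝ) : ℂ) • m j) (c • Pi.single j 1) =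
          ((√n : ℝ) : ℂ) • Pi.single j (m j) := fun j => by
        have h2 : leftAct A n (m j) (Pi.single j 1) = Pi.single j (m j) := by
          ext1 k
          rw [leftAct_apply]
          rcases eq_or_ne k j with rfl | hk
          · simp
          · simp [Pi.single_eq_of_ne hk]
        rw [map_smul, map_smul, LinearMap.smul_apply, h2, smul_smul, smul_smul]
        congr 1
        simp only [c]
        push_cast
        have : (R : ℂ) ≠ 0 := by exact_mod_cast hR.ne'
        field_simp
      have h3 : ∀ j, ‖φ ((2 : ℂ)⁻¹ • leftAct A n (((R⁻¹ : ℝ) : ℂ) • m j) (c • Pi.single j 1))‖ ^ 2 =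
          n * ‖φ (Pi.single j (m j))‖ ^ 2 := fun j => by
        rw [h1, map_smul, norm_smul, mul_pow, Complex.norm_real, Real.norm_eq_abs, sq_abs,
          Real.sq_sqrt n.cast_nonneg]
      have h4 : ‖φ m‖ ^ 2 ≤ n * ∑ j, ‖φ (Pi.single j (m j))‖ ^ 2 := by
        have h5 : m = ∑ j, Pi.single j (m j) := (Finset.univ_sum_single m).symm
        conv_lhs => rw [h5]
        rw [map_sum]
        refine (pow_le_pow_left₀ (norm_nonneg _) (norm_sum_le _ _) 2).trans ?_
        have := sq_sum_le_card_mul_sum_sq (s := Finset.univ)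
          (f := fun j => ‖φ (Pi.single j (m j))‖)
        simpa using this
      have h6 : ∀ j, ‖φ (c • Pi.single j 1)‖ ^ 2 = ‖c‖ ^ 2 * ‖φ (Pi.single j 1)‖ ^ 2 := fun j => by
        rw [map_smul, norm_smul, mul_pow]
      simp only [h3, h6, ← Finset.mul_sum, Finset.univ_eq_empty, Finset.sum_empty]
      linarith
  · intro g m hg
    have := hB Unit Unit inferInstance inferInstance (fun _ => (2 : ℂ)⁻¹ • leftAct A n g m)
      (fun _ => m) 0 ⟨Unit, Empty, inferInstance, inferInstance, fun _ => g, fun _ => m, 0,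
        fun s => s.1.elim, fun _ => hg, le_rfl, fun φ => by simp, by simp⟩
    simpa using this
  · have := hB (Fin n) Empty inferInstance inferInstance (fun j => Pi.single j 1) Empty.elim 1
      ⟨Empty, Empty, inferInstance, inferInstance, Empty.elim, Empty.elim, 1,
        fun s => s.1.elim, fun i => i.elim, zero_le_one, fun φ => by simp, by simp⟩
    simpa using this
  · intro q
    have := hB Empty (Fin n) inferInstance inferInstance Empty.elim q (-‖f q‖ ^ 2)
      ⟨Empty, Unit, inferInstance, inferInstance, Empty.elim, Empty.elim, 0,
        fun s => q s.2, fun i => i.elim, le_rfl, fun φ => by simp [Fintype.sum_prod_type],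
        by simp⟩
    simp only [Finset.univ_eq_empty, Finset.sum_empty] at this
    linarith

end Functional

/-- A functional bounded on transfer functions is dominated by homomorphisms of norm at most two. -/
theorem norm_functional_le {A : Type u} [NormedRing A] [NormedAlgebra ℂ A] {n : ℕ}
    (f : StrongDual ℂ (Fin n → Fin n → A)) (hdec : RemainderDecay A n) (hf : FeedbackBounded f)
    (x : Fin n → Fin n → A) {Φ : ℝ} (hΦ : 0 ≤ Φ)
    (hx : ∀ (H : Type u) [NormedAddCommGroup H] [InnerProductSpace ℂ H] [CompleteSpace H]
      (v : A →ₐ[ℂ] (H →L[ℂ] H)), (∀ a : A, ‖v a‖ ≤ 2 * ‖a‖) → MatBdd v (Matrix.of x) Φ) :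
    ‖f x‖ ≤ Φ := by
  obtain ⟨B, hB1, hB2, hB3⟩ := exists_core_of_functional f hdec hf
  have hact : ∀ a m, (B.inner (leftAct A n a m) (leftAct A n a m)).re ≤
      (2 * ‖a‖) ^ 2 * (B.inner m m).re := by
    obtain ⟨K, _, _, _, j, hj⟩ := exists_hilbert_space_of_core B
    intro a m
    rcases (norm_nonneg a).eq_or_lt with h0 | h0
    · rw [norm_eq_zero.1 h0.symm]
      simp [← hj]
    · have h1 := hB1 (((‖a‖⁻¹ : ℝ) : ℂ) • a) m (by
        rw [norm_smul, Complex.norm_real, norm_inv, norm_norm, inv_mul_cancel₀ h0.ne'])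
      rw [← hj, ← hj] at h1 ⊢
      rw [map_smul, map_smul, LinearMap.smul_apply, map_smul, norm_smul, norm_smul,
        Complex.norm_real, norm_inv, norm_inv, norm_norm, Complex.norm_ofNat] at h1
      rw [sq_le_sq₀ (by positivity) (norm_nonneg _)] at h1
      rw [← mul_pow, sq_le_sq₀ (norm_nonneg _) (by positivity)]
      have h2 : 2⁻¹ * (‖a‖⁻¹ * ‖j (leftAct A n a m)‖) = (2 * ‖a‖)⁻¹ * ‖j (leftAct A n a m)‖ := by
        rw [mul_inv, mul_assoc]
      rwa [h2, inv_mul_le_iff₀ (by positivity)] at h1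
  obtain ⟨K, _, _, _, j, v, hjd, hj, hv⟩ := exists_representation_of_core B (leftAct A n)
    fun a => ⟨2 * ‖a‖, by positivity, hact a⟩
  have hv2 : ∀ a, ‖v a‖ ≤ 2 * ‖a‖ := fun a => by
    refine ContinuousLinearMap.opNorm_le_bound _ (by positivity) fun k => ?_
    induction k using hjd.induction_on with
    | hp => exact isClosed_le (by fun_prop) (by fun_prop)
    | ih m =>
      rw [hv, ← sq_le_sq₀ (norm_nonneg _) (by positivity), mul_pow, hj, hj]
      exact hact a m
  -- The images of the unit vectors have total square norm at most one and are sent by `x` to its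
  -- rows, on which the form dominates `f`.
  have h1 := (matBdd_iff hΦ).1 (hx K v hv2) fun i => j (Pi.single i 1)
  have h2 : ∀ i, ∑ k, v (Matrix.of x i k) (j (Pi.single k 1)) = j (x i) := fun i => by
    simp only [hv, ← map_sum]
    congr 1
    have := congrFun (act_leftAct_single (Matrix.of x) 1) i
    simpa [act_apply] using this
  simp only [h2, hj] at h1
  have h3 := (hB3 x).trans (h1.trans (mul_le_of_le_one_right (sq_nonneg Φ) hB2))
  exact (sq_le_sq₀ (norm_nonneg _) hΦ).1 h3

/-! ### Truncation and the polynomial bound -/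

variable {H₀ : Type u} [NormedAddCommGroup H₀] [InnerProductSpace ℂ H₀]
  {A : Subalgebra ℂ (H₀ →L[ℂ] H₀)}

theorem remainderDecay (n : ℕ) : RemainderDecay A n := by
  intro ι l _ _ _ α γ g hα hγ hg N i k
  have hxb : MatBdd A.val ((2 : ℂ)⁻¹ • Matrix.diagonal g) 2⁻¹ := by
    have := (matBdd_diagonal (v := A.val) zero_le_one hg).smul (2 : ℂ)⁻¹
    simpa using this
  have h1 := ((hγ.matBdd A.val).mul zero_le_one
    (feedbackRem_matBdd hα (by norm_num) hxb N)).entry (by positivity) i k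
  rw [one_mul] at h1
  exact h1.trans (pow_le_pow_of_le_one (by norm_num) (by norm_num) (Nat.le_succ N))

-- Otherwise Hahn–Banach separates `x / Φ` from the degree sums. Since these are balanced, the
-- separating functional is bounded on them in modulus; rescaled, it is at most one on transfer
-- functions, and `norm_functional_le` contradicts the separation.
set_option synthInstance.maxHeartbeats 400000 in
set_option maxHeartbeats 1000000 in
theorem mem_closure_degreeSums {n : ℕ} (x : Fin n → Fin n → A) {Φ : ℝ} (hΦ : 0 < Φ)
    (hx : ∀ (H : Type u) [NormedAddCommGroup H] [InnerProductSpace ℂ H] [CompleteSpace H]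
      (v : A →ₐ[ℂ] (H →L[ℂ] H)), (∀ a : A, ‖v a‖ ≤ 2 * ‖(a : H₀ →L[ℂ] H₀)‖) →
        MatBdd v (Matrix.of x) Φ) :
    ((Φ⁻¹ : ℝ) : ℂ) • x ∈ closure (degreeSums A n) := by
  by_contra hcon
  obtain ⟨f, s, hs, hfx⟩ := RCLike.geometric_hahn_banach_closed_point (𝕜 := ℂ)
    (convex_degreeSums n).closure isClosed_closure hcon
  have hs0 : 0 < s := by
    simpa using hs 0 (subset_closure (zero_mem_degreeSums n))
  have hfs : ∀ y ∈ degreeSums A n, ‖f y‖ ≤ s := fun y hy => by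
    by_cases h0 : f y = 0
    · rw [h0, norm_zero]; exact hs0.le
    have h1 : ‖((‖f y‖⁻¹ : ℝ) : ℂ) * starRingEnd ℂ (f y)‖ ≤ 1 := by
      rw [norm_mul, Complex.norm_real, norm_inv, norm_norm, RCLike.norm_conj,
        inv_mul_cancel₀ (norm_ne_zero_iff.2 h0)]
    have h2 := hs _ (subset_closure (smul_mem_degreeSums hy h1))
    rw [map_smul, smul_eq_mul, mul_assoc, ← Complex.normSq_eq_conj_mul_self,
      Complex.normSq_eq_norm_sq, ← Complex.ofReal_mul, sq, ← mul_assoc,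
      inv_mul_cancel₀ (norm_ne_zero_iff.2 h0), one_mul] at h2
    exact le_of_lt (by simpa using h2)
  have h3 := norm_functional_le (((s⁻¹ : ℝ) : ℂ) • f) (remainderDecay n)
    (fun ι l _ _ _ α γ g hα hγ hg N => by
      change ‖((s⁻¹ : ℝ) : ℂ) • f _‖ ≤ 1
      rw [norm_smul, Complex.norm_real, Real.norm_of_nonneg (by positivity), inv_mul_le_iff₀ hs0,
        mul_one]
      exact hfs _ (mul_feedbackSum_mem_degreeSums hα hγ hg N)) x hΦ.le hx
  change ‖((s⁻¹ : ℝ) : ℂ) • f x‖ ≤ Φ at h3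
  rw [norm_smul, Complex.norm_real, Real.norm_of_nonneg (by positivity), inv_mul_le_iff₀ hs0] at h3
  rw [map_smul, smul_eq_mul] at hfx
  have h4 := hfx.trans_le (RCLike.re_le_norm _)
  rw [norm_mul, Complex.norm_real, Real.norm_of_nonneg (by positivity), lt_inv_mul_iff₀ hΦ] at h4
  linarith

/-- A finite bound improved by `W ↦ a + W / 2` is at most `2 * a`. -/
theorem MatBdd.of_halving_step {B : Type*} [Ring B] [Algebra ℂ B] {E : Type*}
    [NormedAddCommGroup E] [InnerProductSpace ℂ E] {v : B →ₐ[ℂ] (E →L[ℂ] E)} {ι κ : Type*}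
    [Fintype ι] [Fintype κ] {P : Matrix κ ι B → Prop} {a W : ℝ}
    (hW : ∀ X, P X → MatBdd v X W)
    (hstep : ∀ W, (∀ X, P X → MatBdd v X W) → ∀ X, P X → MatBdd v X (a + W / 2)) :
    ∀ X, P X → MatBdd v X (2 * a) := by
  have hk : ∀ k : ℕ, ∀ X, P X → MatBdd v X (2 * a + (W - 2 * a) * 2⁻¹ ^ k) := fun k => by
    induction k with
    | zero => simpa using hW
    | succ k ih =>
      intro X hX
      have h1 := hstep _ ih X hX
      have h2 : a + (2 * a + (W - 2 * a) * 2⁻¹ ^ k) / 2 =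
          2 * a + (W - 2 * a) * 2⁻¹ ^ (k + 1) := by rw [pow_succ]; ring
      rwa [h2] at h1
  intro X hX ξ
  have hlim : Filter.Tendsto (fun k : ℕ => (2 * a + (W - 2 * a) * (2⁻¹ : ℝ) ^ k) *
      ‖WithLp.toLp 2 ξ‖) Filter.atTop
      (nhds ((2 * a + (W - 2 * a) * 0) * ‖WithLp.toLp 2 ξ‖)) :=
    (tendsto_const_nhds.add ((tendsto_pow_atTop_nhds_zero_of_lt_one (by norm_num)
      (by norm_num)).const_mul _)).mul_const _
  rw [mul_zero, add_zero] at hlim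
  exact ge_of_tendsto' hlim fun k => hk k X hX ξ

set_option synthInstance.maxHeartbeats 400000 in
set_option maxHeartbeats 1000000 in
/-- Decomposition of contractive matrices into a part of low degree and a small part. -/
theorem exists_degree_decomposition [CompleteSpace H₀] {n : ℕ} (x : Matrix (Fin n) (Fin n) A)
    {Φ : ℝ} (hΦ : 0 < Φ) {d : ℕ} (hd : Φ * (2 * 2⁻¹ ^ d) ≤ 1 / 4)
    (hx : ∀ (H : Type u) [NormedAddCommGroup H] [InnerProductSpace ℂ H] [CompleteSpace H]
      (v : A →ₐ[ℂ] (H →L[ℂ] H)), (∀ a : A, ‖v a‖ ≤ 2 * ‖(a : H₀ →L[ℂ] H₀)‖) → MatBdd v x Φ) :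
    ∃ y e : Matrix (Fin n) (Fin n) A, x = y + e ∧ MatBdd A.val e (1 / 2) ∧
      ∀ (H : Type u) [NormedAddCommGroup H] [InnerProductSpace ℂ H] [CompleteSpace H]
        (v : A →ₐ[ℂ] (H →L[ℂ] H)) (C : ℝ), 1 ≤ C →
        (∀ a : A, ‖v a‖ ≤ C * ‖(a : H₀ →L[ℂ] H₀)‖) → MatBdd v y (Φ * (d * C ^ d)) := by
  -- The error has norm at most `n² δ`, so after multiplication by Φ it takes at most half of the
  -- allowance `1/2`; the tail takes the other half. The `+ 1` covers `n = 0`.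
  let δ : ℝ := (4 * Φ * (n * n + 1))⁻¹
  have hδ : 0 < δ := by positivity
  obtain ⟨y, ⟨N, z, hz, hy⟩, hyx⟩ := Metric.mem_closure_iff.1
    (mem_closure_degreeSums (fun i j => x i j) hΦ hx) δ hδ
  let lo : Matrix (Fin n) (Fin n) A :=
    ∑ k ∈ (Finset.range N).filter (· < d), ((2 : ℂ)⁻¹) ^ k • z k
  let hi : Matrix (Fin n) (Fin n) A :=
    ∑ k ∈ (Finset.range N).filter (¬ · < d), ((2 : ℂ)⁻¹) ^ k • z k
  let r : Matrix (Fin n) (Fin n) A := ((Φ⁻¹ : ℝ) : ℂ) • x - Matrix.of y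
  have hylohi : Matrix.of y = lo + hi := by
    rw [hy]; exact (Finset.sum_filter_add_sum_filter_not _ _ _).symm
  have hr : MatBdd A.val r (n * n * δ) := by
    have := matBdd_of_entries (v := A.val) (X := r) (δ := δ) fun i j => by
      have h1 := (dist_pi_lt_iff hδ).1 ((dist_pi_lt_iff hδ).1 hyx i) j
      rw [dist_eq_norm] at h1
      exact h1.le
    simpa using this
  -- The inclusion of `A` in `B(H₀)` is itself a homomorphism with `C = 1`, so every `z k` is
  -- contractive and the tail is geometric.
  have hhi : MatBdd A.val hi (2 * 2⁻¹ ^ d) := by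
    refine (MatBdd.sum _ fun k _ => ((hz k H₀ A.val 1 zero_le_one fun a => by
      rw [one_mul]; rfl).smul _)).mono ?_
    have h1 : (Finset.range N).filter (¬ · < d) = Finset.Ico d N := by
      ext k; simp [and_comm]
    simp only [h1, one_pow, mul_one, norm_pow, norm_inv, Complex.norm_ofNat]
    refine (geom_sum_Ico_le_of_lt_one (by norm_num) (by norm_num)).trans (le_of_eq ?_)
    norm_num
    ring
  have hΦn : ‖((Φ : ℝ) : ℂ)‖ = Φ := by rw [Complex.norm_real, Real.norm_of_nonneg hΦ.le]
  refine ⟨(Φ : ℂ) • lo, (Φ : ℂ) • (hi + r), ?_, ?_, fun H _ _ _ v C hC hv => ?_⟩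
  · rw [← smul_add, ← add_assoc, ← hylohi, add_sub_cancel, smul_smul, ← Complex.ofReal_mul,
      mul_inv_cancel₀ hΦ.ne', Complex.ofReal_one, one_smul]
  · refine ((hhi.add hr).smul _).mono ?_
    rw [hΦn, mul_add]
    have h1 : Φ * (n * n * δ) ≤ 1 / 4 := by
      have h2 : Φ * (n * n * δ) = (n * n) / (n * n + 1) * (1 / 4) := by
        simp only [δ]
        field_simp
      rw [h2]
      refine mul_le_of_le_one_left (by norm_num) ?_
      rw [div_le_one (by positivity)]
      linarith
    linarith
  · have hlo : MatBdd v lo (d * C ^ d) := by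
      refine (MatBdd.sum _ fun k _ => ((hz k H v C (by linarith) hv).smul _)).mono ?_
      have h1 : ∀ k ∈ (Finset.range N).filter (· < d), ‖((2 : ℂ)⁻¹) ^ k‖ * C ^ k ≤ C ^ d := by
        intro k hk
        have hkd := (Finset.mem_filter.1 hk).2
        rw [norm_pow, norm_inv, Complex.norm_ofNat]
        exact (mul_le_of_le_one_left (by positivity)
          (pow_le_one₀ (by norm_num) (by norm_num))).trans (pow_le_pow_right₀ hC hkd.le)
      refine (Finset.sum_le_sum h1).trans ?_
      rw [Finset.sum_const, nsmul_eq_mul]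
      refine mul_le_mul_of_nonneg_right ?_ (by positivity)
      have h2 : (Finset.range N).filter (· < d) ⊆ Finset.range d := fun k hk =>
        Finset.mem_range.2 (Finset.mem_filter.1 hk).2
      exact_mod_cast (Finset.card_le_card h2).trans (Finset.card_range d).le
    have := hlo.smul (Φ : ℂ)
    rwa [hΦn] at this

/-- Uniform complete boundedness of homomorphisms of norm two gives a polynomial bound. -/
theorem exists_polynomial_bound [CompleteSpace H₀] {Φ : ℝ} (hΦ : 0 < Φ)
    (hu : ∀ (H : Type u) [NormedAddCommGroup H] [InnerProductSpace ℂ H] [CompleteSpace H]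
      (v : A →ₐ[ℂ] (H →L[ℂ] H)), (∀ a : A, ‖v a‖ ≤ 2 * ‖(a : H₀ →L[ℂ] H₀)‖) →
        cbNorm v ≤ ENNReal.ofReal Φ) :
    ∃ (d : ℕ) (K : ℝ), 0 < d ∧ 0 < K ∧ ∀ (H : Type u) [NormedAddCommGroup H]
      [InnerProductSpace ℂ H] [CompleteSpace H] (v : A →ₐ[ℂ] (H →L[ℂ] H)) (C : ℝ), 1 ≤ C →
      (∀ a : A, ‖v a‖ ≤ C * ‖(a : H₀ →L[ℂ] H₀)‖) → cbNorm v ≤ ENNReal.ofReal (K * C ^ d) := by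
  obtain ⟨d₀, hd₀⟩ := exists_pow_lt_of_lt_one (show (0 : ℝ) < (4 * Φ)⁻¹ by positivity)
    (show (2⁻¹ : ℝ) < 1 by norm_num)
  have hd : Φ * (2 * 2⁻¹ ^ (d₀ + 1)) ≤ 1 / 4 := by
    have h1 : Φ * (2 * 2⁻¹ ^ (d₀ + 1)) = Φ * (2⁻¹ : ℝ) ^ d₀ := by rw [pow_succ]; ring
    rw [h1]
    refine (mul_le_mul_of_nonneg_left hd₀.le hΦ.le).trans (le_of_eq ?_)
    field_simp
  refine ⟨d₀ + 1, 2 * (Φ * (d₀ + 1)), Nat.succ_pos _, by positivity,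
    fun H _ _ _ v C hC hv => ?_⟩
  rw [cbNorm_le_iff v (by positivity)]
  intro n
  -- The initial bound comes from the entries and depends on `n`, but halving forgets it. In the
  -- step, `2 e` is contractive, so the current bound applies to it.
  have key := MatBdd.of_halving_step (v := v)
    (P := fun X : Matrix (Fin n) (Fin n) A => MatBdd A.val X 1)
    (a := Φ * ((d₀ + 1 : ℕ) * C ^ (d₀ + 1)))
    (fun X hX => matBdd_of_entries fun i j => (hv (X i j)).trans
      (mul_le_of_le_one_right (by linarith) (hX.entry zero_le_one i j)))
    (fun W hW X hX => by
      obtain ⟨y, e, hXye, he, hy⟩ := exists_degree_decomposition X hΦ hd fun H _ _ _ w hw =>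
        (cbNorm_le_iff w hΦ.le).1 (hu H w hw) n X hX
      have h1 : MatBdd v e (W / 2) := by
        have h2 : MatBdd A.val ((((1 / 2 : ℝ)⁻¹ : ℝ) : ℂ) • e) 1 := (he.smul _).mono (by
          rw [Complex.norm_real]; norm_num)
        exact ((hW _ h2).of_scaled (by norm_num)).mono (by linarith)
      rw [hXye]
      exact (hy H v C hC hv).add h1)
  intro X hX
  refine (key X hX).mono (le_of_eq ?_)
  push_cast
  ring

theorem one_le_opNorm {H : Type u} [NormedAddCommGroup H] [InnerProductSpace ℂ H] [Nontrivial H]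
    (v : A →ₐ[ℂ] (H →L[ℂ] H)) : 1 ≤ opNorm v := by
  have h1 : ‖((1 : A) : H₀ →L[ℂ] H₀)‖ ≤ 1 := ContinuousLinearMap.norm_id_le
  refine le_trans (le_of_eq ?_) (le_iSup₂ (f := fun (a : A) (_ : ‖(a : H₀ →L[ℂ] H₀)‖ ≤ 1) =>
    ‖v a‖ₑ) 1 h1)
  rw [map_one, ← ofReal_norm, norm_one, ENNReal.ofReal_one]

/-- On a nonzero space `C = ‖v‖` is admissible, because a unital homomorphism has norm at least one.
The zero space is trivial, and `d > 0`, `K > 0` make the right side infinite for unbounded `v`. -/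
theorem cbNorm_le_of_polynomial_bound {H : Type u} [NormedAddCommGroup H] [InnerProductSpace ℂ H]
    (v : A →ₐ[ℂ] (H →L[ℂ] H)) {d : ℕ} {K : ℝ} (hd : 0 < d) (hK : 0 < K)
    (hv : ∀ C : ℝ, 1 ≤ C → (∀ a : A, ‖v a‖ ≤ C * ‖(a : H₀ →L[ℂ] H₀)‖) →
      cbNorm v ≤ ENNReal.ofReal (K * C ^ d)) :
    cbNorm v ≤ (K.toNNReal : ℝ≥0∞) * opNorm v ^ d := by
  rcases subsingleton_or_nontrivial H with hH | hH
  · have : cbNorm v ≤ ENNReal.ofReal 0 := (cbNorm_le_iff v le_rfl).2 fun n x _ ξ => by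
      have : act (vecAct v) x ξ = 0 := funext fun i => Subsingleton.elim _ _
      simp [this]
    rw [ENNReal.ofReal_zero] at this
    exact this.trans zero_le
  by_cases htop : opNorm v = ∞
  · rw [htop, ENNReal.top_pow hd.ne', ENNReal.mul_top (by simpa using hK)]
    exact le_top
  have h1 : opNorm v = ENNReal.ofReal (opNorm v).toReal := (ENNReal.ofReal_toReal htop).symm
  have h2 : 1 ≤ (opNorm v).toReal := by
    have := ENNReal.toReal_mono htop (one_le_opNorm v)
    simpa using this
  refine (hv _ h2 ((opNorm_le_iff v (by linarith)).1 h1.le)).trans (le_of_eq ?_)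
  rw [ENNReal.ofReal_mul hK.le, ENNReal.ofReal_pow (by linarith), ← h1]
  rfl

end OpAlg

end

theorem theorem4p1 {H₀ : Type u} [NormedAddCommGroup H₀] [InnerProductSpace ℂ H₀]
    [CompleteSpace H₀] (A : Subalgebra ℂ (H₀ →L[ℂ] H₀)) :
    List.TFAE [
      ∀ (H : Type u) [NormedAddCommGroup H] [InnerProductSpace ℂ H] [CompleteSpace H]
        (u : A →ₐ[ℂ] (H →L[ℂ] H)), OpAlg.IsBdd u →
          ∃ v : A →ₐ[ℂ] (H →L[ℂ] H), OpAlg.IsSimilar u v ∧ OpAlg.IsCompletelyContractive v,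
      ∀ (H : Type u) [NormedAddCommGroup H] [InnerProductSpace ℂ H] [CompleteSpace H]
        (u : A →ₐ[ℂ] (H →L[ℂ] H)), OpAlg.IsBdd u → OpAlg.IsCompletelyBounded u,
      ∃ (d : ℕ) (K : ℝ≥0),
        ∀ (H : Type u) [NormedAddCommGroup H] [InnerProductSpace ℂ H] [CompleteSpace H]
          (u : A →ₐ[ℂ] (H →L[ℂ] H)), OpAlg.cbNorm u ≤ K * OpAlg.opNorm u ^ d] := by
  tfae_have 1 → 2 := fun h H _ _ _ u hu => by
    obtain ⟨v, huv, hv⟩ := h H u hu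
    exact OpAlg.isCompletelyBounded_of_similar huv hv
  tfae_have 2 → 1 := fun h H _ _ _ u hu =>
    OpAlg.exists_similar_of_isCompletelyBounded u (h H u hu)
  tfae_have 2 → 3 := fun h => by
    obtain ⟨Φ, hΦ, hu⟩ := OpAlg.exists_uniform_cbNorm_bound h 2 zero_le_two
    obtain ⟨d, K, hd, hK, hv⟩ := OpAlg.exists_polynomial_bound (A := A) (Φ := Φ + 1) (by linarith)
      fun H _ _ _ v hv => (hu H v hv).trans (ENNReal.ofReal_le_ofReal (by linarith))
    exact ⟨d, K.toNNReal, fun H _ _ _ u =>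
      OpAlg.cbNorm_le_of_polynomial_bound u hd hK (hv H u)⟩
  tfae_have 3 → 2 := by
    rintro ⟨d, K, h⟩ H _ _ _ u hu
    exact (h H u).trans_lt (ENNReal.mul_lt_top ENNReal.coe_lt_top (ENNReal.pow_lt_top hu))
  tfae_finish
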